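/- Let $G=([n],E)$ be a finite connected graph with vertex set $[n]=\{1,\dots,n\}$, and let $1\le d\le n$ be such that the vertices $1,2,\dots,d$ are pairwise adjacent. Let $\chi_G(q)$ be the chromatic polynomial of $G$ (the polynomial whose value at each positive integer $q$ is the number of proper $q$-colorings of $G$), and let $$\widehat\chi_d(q)=\frac{\chi_G(q)}{q(q-1)\cdots(q-d+1)}.$$ An orientation of $G$ is acyclic if it has no directed cycle; a sink is a vertex without outgoing edges. Given an acyclic orientation $\gamma$ of $G$, let $R_m$ be the set of vertices reachable from $m$ by a directed path (including $m$), and define $S_1,S_2,\dots$ recursively: if $\bigcup_{j<k}S_j=[n]$ then $S_k=\emptyset$; otherwise $S_k=R_m\setminus\bigcup_{j<k}S_j$ with $m=\min\bigl([n]\setminus\bigcup_{j<k}S_j\bigr)$. The nonempty sets among the $S_k$ are the source-components of $\gamma$; they partition $[n]$. Theorem. (a) The vertices of $G$ can be relabeled by a permutation of $[n]$ that fixes $1,\dots,d$ so that, for every $k>1$, the vertex labeled $k$ is adjacent to a vertex with label less than $k$. (b) $\widehat\chi_d(q)$ is a polynomial in $q$. (c) If the labeling of $G$ is such that every vertex $k>1$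 is adjacent to a vertex less than $k$, then for every integer $i\ge 0$, the number $$(-1)^{n-d-i}\,[q^i]\,\widehat\chi_d(q+1)$$ is equal to the number of acyclic orientations of $G$ that have exactly $d+i$ source-components, in which the vertices $1,\dots,d$ lie in pairwise different source-components and the vertex $1$ is the unique sink. -/

import Mathlib

open Polynomial

/-! ### Chromatic polynomial -/

theorem card_coloring_eq_sum {V : Type*} [Finite V] (G : SimpleGraph V) (q : ℕ) :
    Nat.card (G.Coloring (Fin q)) =
      ∑ᶠ r : {r : Setoid V // ∀ u v, G.Adj u v → ¬ r u v},
        q.descFactorial (Nat.card (Quotient r.1)) := by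
  classical
  have := Fintype.ofFinite V
  have : Finite (Setoid V) :=
    Finite.of_injective (fun r : Setoid V => (fun u v => r u v : V → V → Prop))
      (fun r s h => Setoid.ext fun u v => iff_of_eq (congrFun (congrFun h u) v))
  have := Fintype.ofFinite {r : Setoid V // ∀ u v, G.Adj u v → ¬ r u v}
  have : Finite (G.Coloring (Fin q)) := Finite.of_injective (fun f v => f v) DFunLike.coe_injective
  let e : G.Coloring (Fin q) ≃
      (Σ r : {r : Setoid V // ∀ u v, G.Adj u v → ¬ r u v}, (Quotient r.1 ↪ Fin q)) :=
    Equiv.ofBijective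
      (fun f => ⟨⟨Setoid.ker f, fun u v h h' => f.valid h h'⟩,
        ⟨Setoid.kerLift f, Setoid.kerLift_injective f⟩⟩) (by
      constructor
      · intro f g h
        have key : ∀ (x y : Σ r : {r : Setoid V // ∀ u v, G.Adj u v → ¬ r u v},
            (Quotient r.1 ↪ Fin q)), x = y → ∀ v : V,
              x.2 (Quotient.mk x.1.1 v) = y.2 (Quotient.mk y.1.1 v) := by
          rintro x y rfl v; rfl
        exact DFunLike.ext _ _ fun v => key _ _ h v
      · rintro ⟨⟨r, hr⟩, g⟩
        let f : G.Coloring (Fin q) := SimpleGraph.Coloring.mk (fun v => g (Quotient.mk r v))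
          (fun {u v} h h' => hr u v h (Quotient.exact (g.injective h')))
        refine ⟨f, ?_⟩
        have hk : Setoid.ker f = r := by
          ext u v
          constructor
          · intro h; exact Quotient.exact (g.injective h)
          · intro h; exact congrArg g (Quotient.sound h)
        have gen : ∀ (s : Setoid V) (hs : ∀ u v, G.Adj u v → ¬ s u v) (k : Quotient s ↪ Fin q),
            s = r → (∀ v, k (Quotient.mk s v) = g (Quotient.mk r v)) →
            (⟨⟨s, hs⟩, k⟩ : Σ r : {r : Setoid V // ∀ u v, G.Adj u v → ¬ r u v},
              (Quotient r.1 ↪ Fin q)) = ⟨⟨r, hr⟩, g⟩ := by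
          rintro s hs k rfl h
          have : k = g := by
            ext x
            induction x using Quotient.inductionOn with
            | h v => rw [h v]
          rw [this]
        exact gen _ _ _ hk (fun v => rfl))
  rw [Nat.card_congr e, Nat.card_sigma, finsum_eq_sum_of_fintype]
  refine Finset.sum_congr rfl fun r _ => ?_
  have := Fintype.ofFinite (Quotient r.1)
  rw [Nat.card_eq_fintype_card, Fintype.card_embedding_eq, Fintype.card_fin,
    Nat.card_eq_fintype_card]

theorem exists_chromaticPolynomial {V : Type*} [Finite V] (G : SimpleGraph V) :
    ∃ p : ℤ[X], ∀ q : ℕ, 0 < q → p.eval (q : ℤ) = Nat.card (G.Coloring (Fin q)) := by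
  have : Finite (Setoid V) :=
    Finite.of_injective (fun r : Setoid V => (fun u v => r u v : V → V → Prop))
      (fun r s h => Setoid.ext fun u v => iff_of_eq (congrFun (congrFun h u) v))
  have := Fintype.ofFinite {r : Setoid V // ∀ u v, G.Adj u v → ¬ r u v}
  refine ⟨∑ r : {r : Setoid V // ∀ u v, G.Adj u v → ¬ r u v},
    descPochhammer ℤ (Nat.card (Quotient r.1)), fun q _ => ?_⟩
  rw [card_coloring_eq_sum, finsum_eq_sum_of_fintype, eval_finsetSum]
  push_cast
  exact Finset.sum_congr rfl fun r _ => descPochhammer_eval_eq_descFactorial ℤ q _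

/-- The chromatic polynomial of a finite graph `G`: the polynomial whose value at every positive
integer `q` is the number of proper `q`-colorings of `G`. -/
noncomputable def chromaticPolynomial {V : Type*} [Finite V] (G : SimpleGraph V) : ℤ[X] :=
  Classical.choose (exists_chromaticPolynomial G)

theorem chromaticPolynomial_eval {V : Type*} [Finite V] (G : SimpleGraph V) (q : ℕ) (hq : 0 < q) :
    (chromaticPolynomial G).eval (q : ℤ) = Nat.card (G.Coloring (Fin q)) :=
  Classical.choose_spec (exists_chromaticPolynomial G) q hq

theorem chromaticPolynomial_unique {V : Type*} [Finite V] (G : SimpleGraph V) (p : ℤ[X])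
    (hp : ∀ q : ℕ, 0 < q → p.eval (q : ℤ) = Nat.card (G.Coloring (Fin q))) :
    p = chromaticPolynomial G := by
  refine Polynomial.eq_of_infinite_eval_eq _ _ (Set.Infinite.mono ?_
    (Set.infinite_range_of_injective (f := fun k : ℕ => ((k + 1 : ℕ) : ℤ)) ?_))
  · rintro _ ⟨k, rfl⟩
    exact (hp _ k.succ_pos).trans (chromaticPolynomial_eval G _ k.succ_pos).symm
  · intro a b h
    simpa using h

/-- The polynomial `q (q - 1) ⋯ (q - d + 1)`. -/
noncomputable def fallingPolynomial (d : ℕ) : ℤ[X] :=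
  ∏ k ∈ Finset.range d, (X - C (k : ℤ))

/-- The quotient `χ_G(q) / (q (q - 1) ⋯ (q - d + 1))`, as the quotient in the Euclidean division
by a monic polynomial. -/
noncomputable def chiHat {V : Type*} [Finite V] (G : SimpleGraph V) (d : ℕ) : ℤ[X] :=
  chromaticPolynomial G /ₘ fallingPolynomial d

/-! ### Orientations and source-components -/

/-- An orientation of a graph `G`: every edge of `G` gets exactly one of its two directions;
`Arc u v` means that the edge `uv` is directed from `u` to `v`. -/
@[ext]
structure GraphOrientation {V : Type*} (G : SimpleGraph V) where
  Arc : V → V → Prop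
  adj_iff : ∀ u v, G.Adj u v ↔ Arc u v ∨ Arc v u
  asymm : ∀ u v, Arc u v → ¬ Arc v u

namespace GraphOrientation

instance finite {V : Type*} [Finite V] (G : SimpleGraph V) : Finite (GraphOrientation G) :=
  Finite.of_injective (fun γ : GraphOrientation G => γ.Arc) (fun _ _ h => GraphOrientation.ext h)

/-- No directed cycle. -/
def IsAcyclic {V : Type*} {G : SimpleGraph V} (γ : GraphOrientation G) : Prop :=
  ∀ v, ¬ Relation.TransGen γ.Arc v v

/-- A sink is a vertex without outgoing edges. -/
def IsSink {V : Type*} {G : SimpleGraph V} (γ : GraphOrientation G) (v : V) : Prop :=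
  ∀ w, ¬ γ.Arc v w

/-- The set of vertices reachable from `u` by a directed path, including `u`. -/
def reachable {V : Type*} {G : SimpleGraph V} (γ : GraphOrientation G) (u : V) : Set V :=
  {v | Relation.ReflTransGen γ.Arc u v}

/-- The vertices outside of `C` that are reachable from the smallest vertex outside of `C`
(the empty set if there is no vertex outside of `C`). -/
def nextPart {n : ℕ} {G : SimpleGraph (Fin n)} (γ : GraphOrientation G) (C : Set (Fin n)) :
    Set (Fin n) :=
  {v | ∃ m, IsLeast Cᶜ m ∧ v ∈ γ.reachable m \ C}

/-- The union of the first `k` terms of the recursively defined sequence `S₁, S₂, …`. -/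
def covered {n : ℕ} {G : SimpleGraph (Fin n)} (γ : GraphOrientation G) : ℕ → Set (Fin n)
  | 0 => ∅
  | k + 1 => γ.covered k ∪ γ.nextPart (γ.covered k)

/-- The source-components are the nonempty sets among `S₁, S₂, …`, where `S_{k+1}` is the set
`R_m` of vertices reachable from `m` minus `S₁ ∪ ⋯ ∪ S_k`, for `m` the smallest vertex not in
`S₁ ∪ ⋯ ∪ S_k`. -/
def sourceComponents {n : ℕ} {G : SimpleGraph (Fin n)} (γ : GraphOrientation G) :
    Set (Set (Fin n)) :=
  {S | S.Nonempty ∧ ∃ k, S = γ.nextPart (γ.covered k)}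

end GraphOrientation

/-- Every vertex other than the first one is adjacent to a vertex with a smaller label. -/
def HasSmallerNeighbors {n : ℕ} (G : SimpleGraph (Fin n)) : Prop :=
  ∀ k : Fin n, 0 < k.val → ∃ j : Fin n, j < k ∧ G.Adj j k

/-! Call a vertex a leader of an acyclic orientation if no smaller vertex reaches it. Each
source-component contains exactly one leader, so leaders count the components, and the first `d`
vertices are separated exactly when all of them are leaders (`ncard_sourceComponents`,
`separated_iff_subset_leaders`).

Work in the ring of set functions under convolution. Let F(q) sum q^(number of leaders) over the
acyclic orientations of G[S], let I be the signed indicator of independent sets, and I_v its part on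
the sets containing v. Cutting off what the least vertex reaches gives F(q+r) = F(q)F(r)
(`leaderSeries_add`); inclusion–exclusion over sources gives I·F(1) = 1. Hence F(-k) = I^k, which up
to sign counts proper k-colorings.

Let K be the clique of the first d vertices. They lie in different factors of I^(k+d), so I^(k+d)(V)
= (k+d)⋯(k+1)·(∏ I_v · I^k)(V) (`indepSeries_pow_add_card_apply`), and the quotient at k+d is (-1)^n
(∏ I_v · I^k)(V). Let F_K(q) be the sum over orientations where K consists of leaders, with q for
each other leader. On V, F_K(q) = ∏(-I_v)·F(q+d) (`leaderSeries_eq_prod_mul`), so the quotient at q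
is (-1)^(n+d) F_K(-q)(V), a polynomial; this is (b).

For (c), convert only the factors of K without the first vertex, and read the remaining I_1 as
inclusion–exclusion over sets of sinks containing that vertex
(`indepSeriesAt_mul_leaderSeries_univ`). This leaves the orientations with it as unique sink. One
factor fewer is converted, so the argument is -(k+d-1) rather than -(k+d): this is the shift to q+1.
The labeling condition prevents any other sink from being a leader. -/

/-! ### The convolution ring of set functions. -/

/-- Integer-valued functions on finite sets, multiplied by convolution over disjoint unions. -/
@[ext]
structure SetSeries (V : Type*) where
  coeff : Finset V → ℤ

namespace SetSeries

variable {V : Type*}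

instance : CoeFun (SetSeries V) fun _ => Finset V → ℤ := ⟨coeff⟩

theorem ext_apply {f g : SetSeries V} (h : ∀ S, f S = g S) : f = g := SetSeries.ext (funext h)

instance : Add (SetSeries V) := ⟨fun f g => ⟨fun S => f S + g S⟩⟩

instance : Neg (SetSeries V) := ⟨fun f => ⟨fun S => -f S⟩⟩

instance : Zero (SetSeries V) := ⟨⟨fun _ => 0⟩⟩

@[simp]
theorem add_apply (f g : SetSeries V) (S : Finset V) : (f + g) S = f S + g S := rfl

@[simp]
theorem neg_apply (f : SetSeries V) (S : Finset V) : (-f) S = -f S := rfl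

@[simp]
theorem zero_apply (S : Finset V) : (0 : SetSeries V) S = 0 := rfl

variable [DecidableEq V]

instance : Mul (SetSeries V) := ⟨fun f g => ⟨fun S => ∑ T ∈ S.powerset, f T * g (S \ T)⟩⟩

instance : One (SetSeries V) := ⟨⟨fun S => if S = ∅ then 1 else 0⟩⟩

theorem mul_apply (f g : SetSeries V) (S : Finset V) :
    (f * g) S = ∑ T ∈ S.powerset, f T * g (S \ T) := rfl

theorem one_apply (S : Finset V) : (1 : SetSeries V) S = if S = ∅ then 1 else 0 := rfl

protected theorem mul_comm (f g : SetSeries V) : f * g = g * f := by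
  apply ext_apply; intro S
  simp only [mul_apply]
  refine Finset.sum_nbij' (S \ ·) (S \ ·) ?_ ?_ ?_ ?_ ?_
  · intro T _; simp
  · intro T _; simp
  · intro T hT; simpa using hT
  · intro T hT; simpa using hT
  · intro T hT
    simp only [Finset.mem_powerset] at hT
    rw [Finset.sdiff_sdiff_eq_self hT, _root_.mul_comm]

protected theorem mul_assoc (f g h : SetSeries V) : f * g * h = f * (g * h) := by
  apply ext_apply; intro S
  simp only [mul_apply, Finset.sum_mul, Finset.mul_sum]
  rw [Finset.sum_sigma', Finset.sum_sigma']
  refine Finset.sum_nbij' (fun p => ⟨p.2, p.1 \ p.2⟩) (fun p => ⟨p.1 ∪ p.2, p.1⟩) ?_ ?_ ?_ ?_ ?_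
  · rintro ⟨T, R⟩ h
    simp only [Finset.mem_sigma, Finset.mem_powerset] at h ⊢
    exact ⟨h.2.trans h.1, Finset.sdiff_subset_sdiff h.1 le_rfl⟩
  · rintro ⟨R, Q⟩ h
    simp only [Finset.mem_sigma, Finset.mem_powerset] at h ⊢
    exact ⟨Finset.union_subset h.1 (h.2.trans Finset.sdiff_subset), Finset.subset_union_left⟩
  · rintro ⟨T, R⟩ h
    simp only [Finset.mem_sigma, Finset.mem_powerset] at h
    simp [Finset.union_sdiff_of_subset h.2]
  · rintro ⟨R, Q⟩ h
    simp only [Finset.mem_sigma, Finset.mem_powerset] at h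
    have : (R ∪ Q) \ R = Q := Finset.union_sdiff_cancel_left
      (Finset.disjoint_of_subset_right h.2 Finset.disjoint_sdiff)
    simp [this]
  · rintro ⟨T, R⟩ h
    simp only [Finset.mem_sigma, Finset.mem_powerset] at h
    have : (S \ R) \ (T \ R) = S \ T := by
      ext x
      have := @h.2 x
      simp only [Finset.mem_sdiff]
      tauto
    simp [this, _root_.mul_assoc]

protected theorem one_mul (f : SetSeries V) : 1 * f = f := by
  apply ext_apply; intro S
  simp [mul_apply, one_apply]

protected theorem mul_add (f g h : SetSeries V) : f * (g + h) = f * g + f * h := by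
  apply ext_apply; intro S
  simp [mul_apply, _root_.mul_add, Finset.sum_add_distrib]

instance : CommRing (SetSeries V) where
  add_assoc f g h := ext_apply fun S => by simp [add_assoc]
  add_comm f g := ext_apply fun S => by simp [add_comm]
  zero_add f := ext_apply fun S => by simp
  add_zero f := ext_apply fun S => by simp
  neg_add_cancel f := ext_apply fun S => by simp
  mul_assoc := SetSeries.mul_assoc
  mul_comm := SetSeries.mul_comm
  one_mul := SetSeries.one_mul
  mul_one f := by rw [SetSeries.mul_comm, SetSeries.one_mul]
  left_distrib := SetSeries.mul_add
  right_distrib f g h := by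
    rw [SetSeries.mul_comm, SetSeries.mul_add, SetSeries.mul_comm h, SetSeries.mul_comm h]
  zero_mul f := ext_apply fun S => by simp [mul_apply]
  mul_zero f := ext_apply fun S => by simp [mul_apply]
  nsmul := nsmulRec
  zsmul := zsmulRec

/-- Lets inductions use only the sets left after removing a set in the support of the first factor;
such a set often contains a known vertex. -/
theorem mul_apply_congr {f g g' : SetSeries V} {S : Finset V}
    (h : ∀ T ⊆ S, f T ≠ 0 → g (S \ T) = g' (S \ T)) : (f * g) S = (f * g') S := by
  refine Finset.sum_congr rfl fun T hT => ?_
  by_cases hf : f T = 0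
  · rw [hf, zero_mul, zero_mul]
  · rw [h T (Finset.mem_powerset.1 hT) hf]

end SetSeries

/-! ### Cutting and gluing acyclic orientations along a closed set. -/

/-- The relation `A` is an acyclic orientation of the subgraph of `G` induced by `S`. -/
def IsAcyclicOrientationOn {V : Type*} (G : SimpleGraph V) (S : Finset V) (A : V → V → Prop) :
    Prop :=
  (∀ u v, (A u v ∨ A v u) ↔ (G.Adj u v ∧ u ∈ S ∧ v ∈ S)) ∧ ∀ v, ¬ Relation.TransGen A v v

/-- The part of the relation `A` inside the set `T`. -/
def restrictRel {V : Type*} (A : V → V → Prop) (T : Set V) (u v : V) : Prop :=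
  A u v ∧ u ∈ T ∧ v ∈ T

section Relations

variable {V : Type*} {A : V → V → Prop} {R : Set V}

theorem restrictRel_reflTransGen {T : Set V} {u v : V}
    (h : Relation.ReflTransGen (restrictRel A T) u v) : Relation.ReflTransGen A u v :=
  Relation.ReflTransGen.mono (fun _ _ h => h.1) _ _ h

/-- A path starting in a set closed under arcs never leaves it. Dually, by the next lemma, a path
ending outside never met it. -/
theorem transGen_restrictRel_of_mem (hR : ∀ u ∈ R, ∀ v, A u v → v ∈ R) {u v : V} (hu : u ∈ R)
    (h : Relation.TransGen A u v) : v ∈ R ∧ Relation.TransGen (restrictRel A R) u v := by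
  induction h with
  | single h => exact ⟨hR _ hu _ h, .single ⟨h, hu, hR _ hu _ h⟩⟩
  | tail _ h ih => exact ⟨hR _ ih.1 _ h, ih.2.tail ⟨h, ih.1, hR _ ih.1 _ h⟩⟩

theorem transGen_restrictRel_of_notMem (hR : ∀ u ∈ R, ∀ v, A u v → v ∈ R) {u v : V} (hv : v ∉ R)
    (h : Relation.TransGen A u v) : u ∉ R ∧ Relation.TransGen (restrictRel A Rᶜ) u v := by
  induction h using Relation.TransGen.head_induction_on with
  | single h => exact ⟨fun hu => hv (hR _ hu _ h), .single ⟨h, fun hu => hv (hR _ hu _ h), hv⟩⟩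
  | head h _ ih =>
    exact ⟨fun hu => ih.1 (hR _ hu _ h), ih.2.head ⟨h, fun hu => ih.1 (hR _ hu _ h), ih.1⟩⟩

theorem reflTransGen_mem_of_closed (hR : ∀ u ∈ R, ∀ v, A u v → v ∈ R) {u v : V} (hu : u ∈ R)
    (h : Relation.ReflTransGen A u v) : v ∈ R := by
  rcases Relation.reflTransGen_iff_eq_or_transGen.1 h with rfl | h
  · exact hu
  · exact (transGen_restrictRel_of_mem hR hu h).1

theorem reflTransGen_restrictRel_of_mem (hR : ∀ u ∈ R, ∀ v, A u v → v ∈ R) {u v : V} (hu : u ∈ R)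
    (h : Relation.ReflTransGen A u v) : Relation.ReflTransGen (restrictRel A R) u v := by
  rcases Relation.reflTransGen_iff_eq_or_transGen.1 h with rfl | h
  · exact .refl
  · exact (transGen_restrictRel_of_mem hR hu h).2.to_reflTransGen

theorem reflTransGen_restrictRel_of_notMem (hR : ∀ u ∈ R, ∀ v, A u v → v ∈ R) {u v : V}
    (hv : v ∉ R) (h : Relation.ReflTransGen A u v) :
    Relation.ReflTransGen (restrictRel A Rᶜ) u v := by
  rcases Relation.reflTransGen_iff_eq_or_transGen.1 h with rfl | h
  · exact .refl
  · exact (transGen_restrictRel_of_notMem hR hv h).2.to_reflTransGen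

end Relations

namespace IsAcyclicOrientationOn

variable {V : Type*} {G : SimpleGraph V} {S R : Finset V} {A B : V → V → Prop}

theorem adj (h : IsAcyclicOrientationOn G S A) {u v : V} (huv : A u v) : G.Adj u v :=
  ((h.1 u v).1 (.inl huv)).1

theorem left_mem (h : IsAcyclicOrientationOn G S A) {u v : V} (huv : A u v) : u ∈ S :=
  ((h.1 u v).1 (.inl huv)).2.1

theorem right_mem (h : IsAcyclicOrientationOn G S A) {u v : V} (huv : A u v) : v ∈ S :=
  ((h.1 u v).1 (.inl huv)).2.2

theorem restrict (h : IsAcyclicOrientationOn G S A) (hR : R ⊆ S) :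
    IsAcyclicOrientationOn G R (restrictRel A R) := by
  refine ⟨fun u v => ?_, fun v hv => h.2 v (Relation.TransGen.mono (fun _ _ h => h.1) _ _ hv)⟩
  have h1 := h.1 u v
  have h2 := @hR u
  have h3 := @hR v
  simp only [restrictRel, Finset.mem_coe]
  tauto

end IsAcyclicOrientationOn

/-- Two orientations on `R` and on `S \ R`, with all edges between the two sets directed
towards `R`. -/
def glueRel {V : Type*} (G : SimpleGraph V) (S R : Finset V) (A B : V → V → Prop) (u v : V) :
    Prop :=
  A u v ∨ B u v ∨ (G.Adj u v ∧ (u ∈ S ∧ u ∉ R) ∧ v ∈ R)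

section Glue

variable {V : Type*} [DecidableEq V] {G : SimpleGraph V} {S R : Finset V} {A B : V → V → Prop}

theorem glueRel_closed (hA : IsAcyclicOrientationOn G R A)
    (hB : IsAcyclicOrientationOn G (S \ R) B) :
    ∀ u ∈ R, ∀ v, glueRel G S R A B u v → v ∈ R := by
  rintro u hu v (h | h | h)
  · exact hA.right_mem h
  · exact absurd hu (Finset.mem_sdiff.1 (hB.left_mem h)).2
  · exact h.2.2

theorem restrictRel_glueRel_left (hA : IsAcyclicOrientationOn G R A)
    (hB : IsAcyclicOrientationOn G (S \ R) B) : restrictRel (glueRel G S R A B) R = A := by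
  ext u v
  constructor
  · rintro ⟨h | h | h, hu, hv⟩
    · exact h
    · exact absurd hu (Finset.mem_sdiff.1 (hB.left_mem h)).2
    · exact absurd hu h.2.1.2
  · exact fun h => ⟨.inl h, hA.left_mem h, hA.right_mem h⟩

theorem restrictRel_glueRel_right (hA : IsAcyclicOrientationOn G R A)
    (hB : IsAcyclicOrientationOn G (S \ R) B) :
    restrictRel (glueRel G S R A B) (S \ R : Finset V) = B := by
  ext u v
  simp only [restrictRel, Finset.mem_coe]
  constructor
  · rintro ⟨h | h | h, hu, hv⟩
    · exact absurd (hA.left_mem h) (Finset.mem_sdiff.1 hu).2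
    · exact h
    · exact absurd h.2.2 (Finset.mem_sdiff.1 hv).2
  · exact fun h => ⟨.inr (.inl h), hB.left_mem h, hB.right_mem h⟩

/-- No arc leaves `R`, so a directed cycle lies wholly in `R` or wholly outside it, and there it is
a cycle of one of the two pieces. -/
theorem glueRel_isAcyclicOrientationOn (hR : R ⊆ S) (hA : IsAcyclicOrientationOn G R A)
    (hB : IsAcyclicOrientationOn G (S \ R) B) :
    IsAcyclicOrientationOn G S (glueRel G S R A B) := by
  refine ⟨fun u v => ?_, fun v hv => ?_⟩
  · have h1 := hA.1 u v
    have h2 := hB.1 u v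
    have h3 := @hR u
    have h4 := @hR v
    have h5 := G.adj_comm u v
    simp only [Finset.mem_sdiff] at h2
    unfold glueRel
    tauto
  · have hc := glueRel_closed hA hB
    by_cases hvR : v ∈ R
    · have := (transGen_restrictRel_of_mem (R := (R : Set V)) hc hvR hv).2
      rw [restrictRel_glueRel_left hA hB] at this
      exact hA.2 v this
    · have := (transGen_restrictRel_of_notMem (R := (R : Set V)) hc hvR hv).2
      refine hB.2 v (Relation.TransGen.mono ?_ _ _ this)
      rintro a b ⟨h | h | h, ha, hb⟩
      · exact absurd (hA.left_mem h) ha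
      · exact h
      · exact absurd h.2.2 hb

theorem glueRel_restrictRel (hR : R ⊆ S) (hA : IsAcyclicOrientationOn G S A)
    (hc : ∀ u ∈ R, ∀ v, A u v → v ∈ R) :
    glueRel G S R (restrictRel A R) (restrictRel A (S \ R : Finset V)) = A := by
  ext u v
  constructor
  · rintro (h | h | h)
    · exact h.1
    · exact h.1
    · rcases (hA.1 u v).2 ⟨h.1, h.2.1.1, hR h.2.2⟩ with h' | h'
      · exact h'
      · exact absurd (hc _ h.2.2 _ h') h.2.1.2
  · intro h
    have h1 := hc u
    have h2 := hA.left_mem h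
    have h3 := hA.right_mem h
    have h4 := hA.adj h
    simp only [glueRel, restrictRel, Finset.mem_coe, Finset.mem_sdiff]
    by_cases u ∈ R <;> by_cases v ∈ R <;> simp_all

end Glue

open Classical in
/-- The acyclic orientations of the subgraph of `G` induced by `S`. -/
noncomputable def acyclicOrientationsOn {V : Type*} [Fintype V] (G : SimpleGraph V)
    (S : Finset V) : Finset (V → V → Prop) :=
  Finset.univ.filter (IsAcyclicOrientationOn G S)

@[simp]
theorem mem_acyclicOrientationsOn {V : Type*} [Fintype V] {G : SimpleGraph V}
    {S : Finset V} {A : V → V → Prop} :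
    A ∈ acyclicOrientationsOn G S ↔ IsAcyclicOrientationOn G S A := by
  classical
  simp [acyclicOrientationsOn]

-- Edges between `R` and its complement are forced to point into `R`, so an orientation with `R`
-- closed is an arbitrary pair of orientations of the two parts. Every product formula for
-- orientations below comes from this.
open Classical in
theorem sum_acyclicOrientationsOn_closed {V : Type*} [Fintype V] [DecidableEq V]
    (G : SimpleGraph V)
    {S R : Finset V} (hR : R ⊆ S) (φ ψ : (V → V → Prop) → ℤ) :
    ∑ A ∈ (acyclicOrientationsOn G S).filter (fun A => ∀ u ∈ R, ∀ v, A u v → v ∈ R),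
      φ (restrictRel A R) * ψ (restrictRel A (S \ R : Finset V)) =
    (∑ A ∈ acyclicOrientationsOn G R, φ A) * ∑ B ∈ acyclicOrientationsOn G (S \ R), ψ B := by
  rw [Finset.sum_mul_sum, ← Finset.sum_product']
  refine Finset.sum_nbij' (fun A => (restrictRel A R, restrictRel A (S \ R : Finset V)))
    (fun p => glueRel G S R p.1 p.2) ?_ ?_ ?_ ?_ ?_
  · intro A hA
    simp only [Finset.mem_filter, mem_acyclicOrientationsOn, Finset.mem_product] at hA ⊢
    exact ⟨hA.1.restrict hR, hA.1.restrict Finset.sdiff_subset⟩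
  · rintro ⟨A, B⟩ h
    simp only [Finset.mem_filter, mem_acyclicOrientationsOn, Finset.mem_product] at h ⊢
    exact ⟨glueRel_isAcyclicOrientationOn hR h.1 h.2, glueRel_closed h.1 h.2⟩
  · intro A hA
    simp only [Finset.mem_filter, mem_acyclicOrientationsOn] at hA
    exact glueRel_restrictRel hR hA.1 hA.2
  · rintro ⟨A, B⟩ h
    simp only [mem_acyclicOrientationsOn, Finset.mem_product] at h
    exact Prod.ext (restrictRel_glueRel_left h.1 h.2) (restrictRel_glueRel_right h.1 h.2)
  · intro A _
    rfl

theorem acyclicOrientationsOn_empty {V : Type*} [Fintype V] {G : SimpleGraph V} : acyclicOrientationsOn G ∅ = {fun _ _ => False} := by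
  ext A
  rw [mem_acyclicOrientationsOn, Finset.mem_singleton]
  constructor
  · intro h
    ext u v
    simpa using fun h' => absurd (h.left_mem h') (Finset.notMem_empty _)
  · rintro rfl
    refine ⟨by simp, fun v h => ?_⟩
    obtain ⟨_, h, -⟩ := Relation.TransGen.head'_iff.1 h
    exact h

/-! ### Signed independent sets, and leaders. -/

open Classical in
/-- The independent sets, with sign. -/
noncomputable def indepSeries {V : Type*} (G : SimpleGraph V) : SetSeries V where
  coeff S := if ∀ u ∈ S, ∀ v ∈ S, ¬ G.Adj u v then (-1) ^ S.card else 0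

/-- The independent sets that contain `m`, with sign. -/
noncomputable def indepSeriesAt {V : Type*} [DecidableEq V] (G : SimpleGraph V) (m : V) : SetSeries V where
  coeff S := if m ∈ S then indepSeries G S else 0

theorem indepSeriesAt_mul_apply_of_notMem {V : Type*} [DecidableEq V] {G : SimpleGraph V}
    {m : V} {S : Finset V} (hm : m ∉ S) (f : SetSeries V) :
    (indepSeriesAt G m * f) S = 0 := by
  refine Finset.sum_eq_zero fun T hT => ?_
  have : m ∉ T := fun h => hm (Finset.mem_powerset.1 hT h)
  simp [indepSeriesAt, this]

open Classical in
/-- The vertices of `S` that cannot be reached from a smaller vertex. -/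
noncomputable def leaders {V : Type*} [LinearOrder V] (S : Finset V) (A : V → V → Prop) :
    Finset V :=
  S.filter fun m => ∀ j < m, ¬ Relation.ReflTransGen A j m

theorem mem_leaders {V : Type*} [LinearOrder V] {S : Finset V} {A : V → V → Prop} {m : V} :
    m ∈ leaders S A ↔ m ∈ S ∧ ∀ j < m, ¬ Relation.ReflTransGen A j m := by
  classical
  simp [leaders]

theorem leaders_subset {V : Type*} [LinearOrder V] (S : Finset V) (A : V → V → Prop) :
    leaders S A ⊆ S := fun _ h => (mem_leaders.1 h).1

theorem IsAcyclicOrientationOn.restrictRel_sdiff {V : Type*} [DecidableEq V] {G : SimpleGraph V}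
    {S : Finset V} {A : V → V → Prop} (hA : IsAcyclicOrientationOn G S A) (R : Finset V) :
    restrictRel A (S \ R : Finset V) = restrictRel A (R : Set V)ᶜ := by
  ext u v
  have h1 : A u v → u ∈ S := hA.left_mem
  have h2 : A u v → v ∈ S := hA.right_mem
  simp only [restrictRel, Finset.mem_coe, Finset.mem_sdiff, Set.mem_compl_iff]
  tauto

/-- Paths ending outside a closed set avoid it, so deleting the set does not change which of the
other vertices are leaders. -/
theorem leaders_sdiff {V : Type*} [LinearOrder V] {G : SimpleGraph V} {S R : Finset V}
    {A : V → V → Prop} (hA : IsAcyclicOrientationOn G S A)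
    (hR : ∀ u ∈ R, ∀ v, A u v → v ∈ R) :
    leaders (S \ R) (restrictRel A (S \ R : Finset V)) = leaders S A \ R := by
  ext m
  rw [hA.restrictRel_sdiff, Finset.mem_sdiff, mem_leaders, mem_leaders, Finset.mem_sdiff]
  constructor
  · rintro ⟨⟨h1, h2⟩, h3⟩
    exact ⟨⟨h1, fun j hj h => h3 j hj
      (reflTransGen_restrictRel_of_notMem (R := (R : Set V)) hR h2 h)⟩, h2⟩
  · rintro ⟨⟨h1, h2⟩, h3⟩
    exact ⟨⟨h1, h3⟩, fun j hj h => h2 j hj (restrictRel_reflTransGen h)⟩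

/-- The weight of a leader set: `q` for every leader outside of `K`, provided that all elements
of `K` are leaders. -/
def leaderWeight {V : Type*} [DecidableEq V] (K : Finset V) (q : ℤ) (L : Finset V) : ℤ :=
  if K ⊆ L then q ^ (L \ K).card else 0

theorem leaderWeight_of_inter_eq {V : Type*} [DecidableEq V] {K L R : Finset V} {m : V} (q : ℤ)
    (h : L ∩ R = {m}) :
    leaderWeight K q L = (if m ∈ K then 1 else q) * leaderWeight (K.erase m) q (L \ R) := by
  have hm : ∀ x, x ∈ L ∧ x ∈ R ↔ x = m := fun x => by
    rw [← Finset.mem_inter, h, Finset.mem_singleton]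
  have hiff : K ⊆ L ↔ K.erase m ⊆ L \ R := by
    constructor
    · intro hKL x hx
      rw [Finset.mem_erase] at hx
      rw [Finset.mem_sdiff]
      exact ⟨hKL hx.2, fun hxR => hx.1 ((hm x).1 ⟨hKL hx.2, hxR⟩)⟩
    · intro h' x hx
      by_cases hxm : x = m
      · exact ((hm x).2 hxm).1
      · exact (Finset.mem_sdiff.1 (h' (Finset.mem_erase.2 ⟨hxm, hx⟩))).1
  unfold leaderWeight
  by_cases hKL : K ⊆ L
  · rw [if_pos hKL, if_pos (hiff.1 hKL)]
    by_cases hmK : m ∈ K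
    · rw [if_pos hmK, one_mul]
      congr 2
      ext x
      have := hm x
      simp only [Finset.mem_sdiff, Finset.mem_erase]
      by_cases hx : x = m
      · subst hx; tauto
      · tauto
    · rw [if_neg hmK, ← pow_succ']
      congr 1
      have : L \ K = insert m ((L \ R) \ K.erase m) := by
        ext x
        have := hm x
        simp only [Finset.mem_sdiff, Finset.mem_erase, Finset.mem_insert]
        by_cases hx : x = m
        · subst hx; tauto
        · tauto
      rw [this, Finset.card_insert_of_notMem]
      have := hm m
      simp only [Finset.mem_sdiff, Finset.mem_erase]
      tauto
  · rw [if_neg hKL, if_neg (fun h => hKL (hiff.2 h)), mul_zero]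

/-! ### The leader generating function and its multiplicativity. -/

section Series

variable {V : Type*} [Fintype V] [LinearOrder V] (G : SimpleGraph V)

/-- The acyclic orientations of `G[S]` in which all elements of `K` are leaders, with weight `q`
for every other leader. -/
noncomputable def leaderSeries (K : Finset V) (q : ℤ) : SetSeries V where
  coeff S := ∑ A ∈ acyclicOrientationsOn G S, leaderWeight K q (leaders S A)

open Classical in
/-- The number of acyclic orientations of `G[S]` in which all vertices can be reached from `m`. -/
noncomputable def rootedSeries (m : V) : SetSeries V where
  coeff S := ∑ A ∈ acyclicOrientationsOn G S,
    if m ∈ S ∧ ∀ w ∈ S, Relation.ReflTransGen A m w then 1 else 0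

variable {G}

theorem mem_of_rootedSeries_ne_zero {m : V} {S : Finset V} (h : rootedSeries G m S ≠ 0) :
    m ∈ S := by
  by_contra hm
  exact h (by simp [rootedSeries, hm])

theorem rootedSeries_mul_apply_of_notMem {m : V} {S : Finset V} (hm : m ∉ S) (f : SetSeries V) :
    (rootedSeries G m * f) S = 0 := by
  refine Finset.sum_eq_zero fun T hT => ?_
  rw [by_contra fun h => hm (Finset.mem_powerset.1 hT (mem_of_rootedSeries_ne_zero h)), zero_mul]

-- Split each orientation along the set `R` reachable from the least vertex `m`. This set is closed
-- and rooted at `m`, and `m` is its only leader, contributing `1` or `q` according to whether `m ∈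
-- K`.
open Classical in
theorem leaderSeries_eq_rootedSeries_mul (K : Finset V) (q : ℤ) {S : Finset V} {m : V}
    (hm : m ∈ S) (hmin : ∀ v ∈ S, m ≤ v) :
    leaderSeries G K q S =
      (if m ∈ K then 1 else q) * (rootedSeries G m * leaderSeries G (K.erase m) q) S := by
  rw [SetSeries.mul_apply, Finset.mul_sum]
  simp only [leaderSeries]
  rw [← Finset.sum_fiberwise_of_maps_to
    (g := fun A : V → V → Prop => S.filter (Relation.ReflTransGen A m)) (t := S.powerset)
    (fun A _ => Finset.mem_powerset.2 (Finset.filter_subset _ _))]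
  refine Finset.sum_congr rfl fun R hR => ?_
  rw [Finset.mem_powerset] at hR
  simp only [rootedSeries]
  rw [← sum_acyclicOrientationsOn_closed G hR, Finset.mul_sum, Finset.sum_filter,
    Finset.sum_filter]
  refine Finset.sum_congr rfl fun A hA => ?_
  rw [mem_acyclicOrientationsOn] at hA
  by_cases hAR : S.filter (Relation.ReflTransGen A m) = R
  · have hmem : ∀ v, v ∈ R ↔ v ∈ S ∧ Relation.ReflTransGen A m v := by simp [← hAR]
    have hc : ∀ u ∈ R, ∀ v, A u v → v ∈ R := fun u hu v h =>
      (hmem v).2 ⟨hA.right_mem h, ((hmem u).1 hu).2.tail h⟩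
    have hmR : m ∈ R := (hmem m).2 ⟨hm, .refl⟩
    have hL : leaders S A ∩ R = {m} := by
      ext x
      rw [Finset.mem_inter, mem_leaders, Finset.mem_singleton]
      constructor
      · rintro ⟨h1, h2⟩
        by_contra hx
        exact h1.2 m (lt_of_le_of_ne (hmin x h1.1) (Ne.symm hx)) ((hmem x).1 h2).2
      · rintro rfl
        refine ⟨⟨hm, fun j hj h => ?_⟩, hmR⟩
        rcases Relation.ReflTransGen.cases_head h with rfl | ⟨c, h, -⟩
        · exact lt_irrefl _ hj
        · exact absurd (hmin j (hA.left_mem h)) (not_le.2 hj)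
    have hr : m ∈ R ∧ ∀ w ∈ R, Relation.ReflTransGen (restrictRel A R) m w :=
      ⟨hmR, fun w hw => reflTransGen_restrictRel_of_mem (R := (R : Set V)) hc hmR
        ((hmem w).1 hw).2⟩
    rw [if_pos hAR, if_pos hc, if_pos hr, one_mul, leaders_sdiff hA hc,
      leaderWeight_of_inter_eq q hL]
  -- A closed `R` all of whose vertices are reached from `m` inside `R` would be the reachable set;
  -- so on the product side the term vanishes too.
  · rw [if_neg hAR]
    by_cases hc : ∀ u ∈ R, ∀ v, A u v → v ∈ R
    swap
    · rw [if_neg hc]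
    by_cases hr : m ∈ R ∧ ∀ w ∈ R, Relation.ReflTransGen (restrictRel A R) m w
    · refine absurd ?_ hAR
      ext x
      rw [Finset.mem_filter]
      exact ⟨fun h => reflTransGen_mem_of_closed (R := (R : Set V)) hc hr.1 h.2,
        fun h => ⟨hR h, restrictRel_reflTransGen (hr.2 x h)⟩⟩
    · rw [if_neg hr, zero_mul, mul_zero, ite_self]

theorem leaderSeries_empty (q : ℤ) : leaderSeries G ∅ q ∅ = 1 := by
  simp [leaderSeries, acyclicOrientationsOn_empty, leaderWeight,
    Finset.subset_empty.1 (leaders_subset ∅ _)]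

theorem leaderSeries_eq (q : ℤ) {S : Finset V} {m : V} (hm : m ∈ S) (hmin : ∀ v ∈ S, m ≤ v) :
    leaderSeries G ∅ q S = q * (rootedSeries G m * leaderSeries G ∅ q) S := by
  simpa using leaderSeries_eq_rootedSeries_mul (G := G) ∅ q hm hmin

/-- By strong induction both sides satisfy the same recursion obtained by peeling off the part
rooted at the least vertex. -/
theorem leaderSeries_add (q r : ℤ) :
    leaderSeries G ∅ (q + r) = leaderSeries G ∅ q * leaderSeries G ∅ r := by
  apply SetSeries.ext_apply; intro S
  induction S using Finset.strongInduction with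
  | H S ih =>
    rcases S.eq_empty_or_nonempty with rfl | hS
    · simp [SetSeries.mul_apply, leaderSeries_empty]
    set m := S.min' hS
    have hm : m ∈ S := S.min'_mem hS
    have hmin : ∀ v ∈ S, m ≤ v := fun v hv => S.min'_le v hv
    set U := rootedSeries G m
    set F := leaderSeries G ∅
    -- A product rule: the least vertex lies in exactly one of the two blocks, and only that block
    -- is expanded; the term rooted in the other block is zero.
    have h1 : (F q * F r) S = q * (U * F q * F r) S + r * (U * F r * F q) S := by
      rw [SetSeries.mul_comm (U * F r), SetSeries.mul_apply, SetSeries.mul_apply,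
        SetSeries.mul_apply, Finset.mul_sum, Finset.mul_sum, ← Finset.sum_add_distrib]
      refine Finset.sum_congr rfl fun T hT => ?_
      rw [Finset.mem_powerset] at hT
      by_cases hmT : m ∈ T
      · rw [leaderSeries_eq q hmT fun v hv => hmin v (hT hv),
          rootedSeries_mul_apply_of_notMem (S := S \ T) (by simp [hmT])]
        ring
      · rw [leaderSeries_eq r (S := S \ T) (by simp [hm, hmT])
          fun v hv => hmin v (Finset.mem_sdiff.1 hv).1, rootedSeries_mul_apply_of_notMem hmT]
        ring
    have h2 : (U * F (q + r)) S = (U * (F q * F r)) S :=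
      SetSeries.mul_apply_congr fun T hT h => ih _
        (Finset.sdiff_ssubset hT ⟨m, mem_of_rootedSeries_ne_zero h⟩)
    rw [h1, leaderSeries_eq (q + r) hm hmin, h2, mul_assoc, mul_assoc, mul_comm (F r)]
    ring

theorem leaderSeries_zero : leaderSeries G ∅ 0 = 1 := by
  apply SetSeries.ext_apply; intro S
  rcases S.eq_empty_or_nonempty with rfl | hS
  · simp [leaderSeries_empty, SetSeries.one_apply]
  · rw [leaderSeries_eq 0 (S.min'_mem hS) fun v hv => S.min'_le v hv]
    simp [SetSeries.one_apply, hS.ne_empty]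

end Series

/-! ### Inclusion–exclusion over sources and sinks. -/

theorem sum_powerset_mul_sum_ite_subset {V ι : Type*} [DecidableEq V] (S : Finset V)
    (a : Finset ι) (s : ι → Finset V) (hs : ∀ A ∈ a, s A ⊆ S) (c : Finset V → ℤ) (w : ι → ℤ) :
    ∑ T ∈ S.powerset, c T * ∑ A ∈ a, (if T ⊆ s A then w A else 0) =
      ∑ A ∈ a, w A * ∑ T ∈ (s A).powerset, c T := by
  simp only [Finset.mul_sum]
  rw [Finset.sum_comm]
  refine Finset.sum_congr rfl fun A hA => ?_
  have : (s A).powerset = S.powerset.filter (· ⊆ s A) := by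
    ext T
    simp only [Finset.mem_powerset, Finset.mem_filter]
    exact ⟨fun h => ⟨h.trans (hs A hA), h⟩, And.right⟩
  rw [this, Finset.sum_filter]
  refine Finset.sum_congr rfl fun T _ => ?_
  split_ifs
  · ring
  · ring

/-- Up to sign this is the alternating sum over the subsets of `X` without `m`, which vanishes
unless nothing but `m` is present. -/
theorem sum_powerset_neg_one_pow_card_of_mem {V : Type*} [DecidableEq V] (X : Finset V) (m : V) :
    ∑ T ∈ X.powerset, (if m ∈ T then (-1 : ℤ) ^ T.card else 0) = if X = {m} then -1 else 0 := by
  by_cases hm : m ∈ X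
  · obtain ⟨Y, hY, rfl⟩ : ∃ Y, m ∉ Y ∧ insert m Y = X :=
      ⟨X.erase m, Finset.notMem_erase _ _, Finset.insert_erase hm⟩
    rw [Finset.sum_powerset_insert hY, Finset.sum_eq_zero, zero_add]
    · have : ∑ T ∈ Y.powerset, (if m ∈ insert m T then (-1 : ℤ) ^ (insert m T).card else 0) =
          -∑ T ∈ Y.powerset, (-1 : ℤ) ^ T.card := by
        rw [← Finset.sum_neg_distrib]
        refine Finset.sum_congr rfl fun T hT => ?_
        rw [if_pos (Finset.mem_insert_self _ _), Finset.card_insert_of_notMem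
          (fun h => hY (Finset.mem_powerset.1 hT h)), pow_succ]
        ring
      rw [this, Finset.sum_powerset_neg_one_pow_card]
      have : insert m Y = {m} ↔ Y = ∅ := by
        constructor
        · intro h
          rw [Finset.eq_empty_iff_forall_notMem]
          intro x hx
          have : x ∈ ({m} : Finset V) := h ▸ Finset.mem_insert_of_mem hx
          exact hY (Finset.mem_singleton.1 this ▸ hx)
        · rintro rfl; rfl
      simp only [this]
      split_ifs <;> simp
    · intro T hT
      rw [if_neg fun h => hY (Finset.mem_powerset.1 hT h)]
  · rw [Finset.sum_eq_zero, if_neg]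
    · rintro rfl
      exact hm (Finset.mem_singleton_self _)
    · intro T hT
      rw [if_neg fun h => hm (Finset.mem_powerset.1 hT h)]

open Classical in
/-- The vertices of `S` without incoming arcs. -/
noncomputable def sourcesIn {V : Type*} (S : Finset V) (A : V → V → Prop) : Finset V :=
  S.filter fun v => ∀ u, ¬ A u v

open Classical in
/-- The vertices of `S` without outgoing arcs. -/
noncomputable def sinksIn {V : Type*} (S : Finset V) (A : V → V → Prop) : Finset V :=
  S.filter fun v => ∀ w, ¬ A v w

theorem mem_sourcesIn {V : Type*} {S : Finset V} {A : V → V → Prop} {v : V} :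
    v ∈ sourcesIn S A ↔ v ∈ S ∧ ∀ u, ¬ A u v := by
  classical
  simp [sourcesIn]

theorem mem_sinksIn {V : Type*} {S : Finset V} {A : V → V → Prop} {v : V} :
    v ∈ sinksIn S A ↔ v ∈ S ∧ ∀ w, ¬ A v w := by
  classical
  simp [sinksIn]

theorem IsAcyclicOrientationOn.exists_source {V : Type*} [Finite V] {G : SimpleGraph V}
    {S : Finset V} {A : V → V → Prop} (hA : IsAcyclicOrientationOn G S A) {w : V} (hw : w ∈ S) :
    ∃ v ∈ sourcesIn S A, Relation.ReflTransGen A v w := by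
  have : IsTrans V (Relation.TransGen A) := ⟨fun _ _ _ h h' => h.trans h'⟩
  have : Std.Irrefl (Relation.TransGen A) := ⟨hA.2⟩
  have hwf := Finite.wellFounded_of_trans_of_irrefl (Relation.TransGen A)
  induction w using hwf.induction with
  | _ w ih =>
    by_cases h : ∃ u, A u w
    · obtain ⟨u, hu⟩ := h
      obtain ⟨v, hv, hvu⟩ := ih u (.single hu) (hA.left_mem hu)
      exact ⟨v, hv, hvu.tail hu⟩
    · push Not at h
      exact ⟨w, mem_sourcesIn.2 ⟨hw, h⟩, .refl⟩

/-- By finiteness and acyclicity every vertex is reached from some source, while a source is reached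
only from itself. -/
theorem IsAcyclicOrientationOn.sourcesIn_eq_singleton_iff {V : Type*} [Finite V]
    {G : SimpleGraph V} {S : Finset V} {A : V → V → Prop} (hA : IsAcyclicOrientationOn G S A)
    {m : V} : sourcesIn S A = {m} ↔ m ∈ S ∧ ∀ w ∈ S, Relation.ReflTransGen A m w := by
  constructor
  · intro h
    refine ⟨(mem_sourcesIn.1 (h ▸ Finset.mem_singleton_self m)).1, fun w hw => ?_⟩
    obtain ⟨v, hv, hvw⟩ := hA.exists_source hw
    rw [h, Finset.mem_singleton] at hv
    exact hv ▸ hvw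
  · rintro ⟨hm, h⟩
    obtain ⟨v, hv, -⟩ := hA.exists_source hm
    have key : ∀ v ∈ sourcesIn S A, v = m := by
      intro v hv
      rw [mem_sourcesIn] at hv
      rcases Relation.ReflTransGen.cases_tail (h v hv.1) with h' | ⟨c, -, hc⟩
      · exact h'
      · exact absurd hc (hv.2 c)
    exact Finset.eq_singleton_iff_unique_mem.2 ⟨key v hv ▸ hv, key⟩

section Series

variable {V : Type*} [Fintype V] {G : SimpleGraph V}

open Classical in
theorem sum_acyclicOrientationsOn_noArcs (T : Finset V) :
    ∑ A ∈ acyclicOrientationsOn G T, (if ∀ u v, ¬ A u v then (1 : ℤ) else 0) =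
      if ∀ u ∈ T, ∀ v ∈ T, ¬ G.Adj u v then 1 else 0 := by
  split_ifs with h
  · have hE : IsAcyclicOrientationOn G T fun _ _ => False := by
      refine ⟨fun u v => ?_, fun v h => ?_⟩
      · simpa using fun h' hu hv => h u hu v hv h'
      · obtain ⟨_, h, -⟩ := Relation.TransGen.head'_iff.1 h
        exact h
    rw [Finset.sum_eq_single_of_mem _ (mem_acyclicOrientationsOn.2 hE)]
    · simp
    · intro A _ hne
      refine if_neg fun h' => hne ?_
      ext u v
      simpa using h' u v
  · refine Finset.sum_eq_zero fun A hA => if_neg fun h' => h fun u hu v hv huv => ?_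
    rcases ((mem_acyclicOrientationsOn.1 hA).1 u v).2 ⟨huv, hu, hv⟩ with h1 | h1
    · exact h' _ _ h1
    · exact h' _ _ h1

open Classical in
theorem indepSeries_apply (T : Finset V) : indepSeries G T =
    (-1) ^ T.card * ∑ A ∈ acyclicOrientationsOn G T, (if ∀ u v, ¬ A u v then 1 else 0) := by
  rw [sum_acyclicOrientationsOn_noArcs]
  simp [indepSeries]

variable [LinearOrder V]

theorem leaderSeries_one_apply (S : Finset V) :
    leaderSeries G ∅ 1 S = ∑ _A ∈ acyclicOrientationsOn G S, 1 := by
  simp [leaderSeries, leaderWeight]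

-- An acyclic orientation of `S \ T`, extended by arcs from the independent set `T` into `S \ T`, is
-- the same as an acyclic orientation of `S` in which all of `T` are sources.
open Classical in
theorem indepSeries_mul_leaderSeries_one {S T : Finset V} (hT : T ⊆ S) :
    indepSeries G T * leaderSeries G ∅ 1 (S \ T) =
      (-1) ^ T.card * ∑ A ∈ acyclicOrientationsOn G S, if T ⊆ sourcesIn S A then 1 else 0 := by
  -- The closed part is the complement of `T`; the second weight forces `T` to carry no arcs.
  have h := sum_acyclicOrientationsOn_closed G (S := S) (R := S \ T) Finset.sdiff_subset
    (fun _ => 1) (fun A => if ∀ u v, ¬ A u v then 1 else 0)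
  rw [Finset.sdiff_sdiff_eq_self hT] at h
  rw [indepSeries_apply, leaderSeries_one_apply, mul_assoc, mul_comm (∑ A ∈ _, _), ← h,
    Finset.sum_filter]
  congr 1
  refine Finset.sum_congr rfl fun A hA => ?_
  rw [mem_acyclicOrientationsOn] at hA
  rw [one_mul, ← ite_and]
  refine if_congr ⟨fun ⟨h1, h2⟩ v hv => mem_sourcesIn.2 ⟨hT hv, fun u hu => ?_⟩,
    fun h => ⟨fun u _ v huv => Finset.mem_sdiff.2 ⟨hA.right_mem huv, fun hv =>
      (mem_sourcesIn.1 (h hv)).2 u huv⟩, fun u v huv => (mem_sourcesIn.1 (h huv.2.2)).2 u huv.1⟩⟩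
      rfl rfl
  by_cases huT : u ∈ T
  · exact h2 u v ⟨hu, huT, hv⟩
  · exact (Finset.mem_sdiff.1 (h1 u (Finset.mem_sdiff.2 ⟨hA.left_mem hu, huT⟩) v hu)).2 hv

/-- The alternating sum over sets of sources vanishes, since a nonempty acyclic orientation has a
source. -/
theorem indepSeries_mul_leaderSeries : indepSeries G * leaderSeries G ∅ 1 = 1 := by
  classical
  apply SetSeries.ext_apply; intro S
  rw [SetSeries.mul_apply, Finset.sum_congr rfl fun T hT =>
    indepSeries_mul_leaderSeries_one (Finset.mem_powerset.1 hT),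
    sum_powerset_mul_sum_ite_subset _ _ _
      (fun A _ v hv => (mem_sourcesIn.1 hv).1) (fun T => (-1) ^ T.card)]
  simp only [Finset.sum_powerset_neg_one_pow_card, one_mul, SetSeries.one_apply]
  rcases S.eq_empty_or_nonempty with rfl | ⟨w, hw⟩
  · simp [acyclicOrientationsOn_empty, sourcesIn]
  · rw [if_neg (Finset.ne_empty_of_mem hw)]
    refine Finset.sum_eq_zero fun A hA => if_neg ?_
    obtain ⟨v, hv, -⟩ := (mem_acyclicOrientationsOn.1 hA).exists_source hw
    exact Finset.ne_empty_of_mem hv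

/-- The same inclusion–exclusion over sets of sources containing `m` leaves the orientations with
`m` as only source, that is, those rooted at `m`. -/
theorem indepSeriesAt_mul_leaderSeries (m : V) :
    indepSeriesAt G m * leaderSeries G ∅ 1 = -rootedSeries G m := by
  classical
  apply SetSeries.ext_apply; intro S
  have h : ∀ T ∈ S.powerset, indepSeriesAt G m T * leaderSeries G ∅ 1 (S \ T) =
      (if m ∈ T then (-1) ^ T.card else 0) *
        ∑ A ∈ acyclicOrientationsOn G S, if T ⊆ sourcesIn S A then 1 else 0 := by
    intro T hT
    by_cases hm : m ∈ T
    · simp only [indepSeriesAt, if_pos hm]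
      exact indepSeries_mul_leaderSeries_one (Finset.mem_powerset.1 hT)
    · simp only [indepSeriesAt, if_neg hm, zero_mul]
  rw [SetSeries.mul_apply, Finset.sum_congr rfl h, sum_powerset_mul_sum_ite_subset _ _ _
      (fun A _ v hv => (mem_sourcesIn.1 hv).1) (fun T => if m ∈ T then (-1) ^ T.card else 0),
      SetSeries.neg_apply]
  simp only [rootedSeries]
  rw [← Finset.sum_neg_distrib]
  refine Finset.sum_congr rfl fun A hA => ?_
  rw [sum_powerset_neg_one_pow_card_of_mem, one_mul]
  simp only [(mem_acyclicOrientationsOn.1 hA).sourcesIn_eq_singleton_iff]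
  split_ifs <;> simp

theorem leaderSeries_neg_one : leaderSeries G ∅ (-1) = indepSeries G := by
  have h : leaderSeries G ∅ 1 * leaderSeries G ∅ (-1) = 1 := by
    rw [← leaderSeries_add, add_neg_cancel, leaderSeries_zero]
  calc leaderSeries G ∅ (-1)
      = (indepSeries G * leaderSeries G ∅ 1) * leaderSeries G ∅ (-1) := by
        rw [indepSeries_mul_leaderSeries, one_mul]
    _ = indepSeries G := by rw [mul_assoc, h, mul_one]

theorem leaderSeries_neg_natCast (k : ℕ) : leaderSeries G ∅ (-k) = indepSeries G ^ k := by
  induction k with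
  | zero => simp [leaderSeries_zero]
  | succ k ih =>
    rw [pow_succ, ← ih, ← leaderSeries_neg_one, ← leaderSeries_add]
    congr 1
    push_cast
    ring

/-- Peel off the parts rooted at the elements of `K` in increasing order. Each rooted series is
`-indepSeriesAt` times `leaderSeries G ∅ 1`, and these extra factors raise `q` by one per element of
`K`. The hypothesis on `S` keeps the current element of `K` the least remaining vertex. -/
theorem leaderSeries_eq_prod_mul (K : Finset V) (q : ℤ) (S : Finset V)
    (hS : ∀ u ∈ S, u ∈ K ∨ ∀ v ∈ K, v < u) :
    leaderSeries G K q S =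
      ((∏ v ∈ K, -indepSeriesAt G v) * leaderSeries G ∅ (q + K.card)) S := by
  induction K using Finset.induction_on_min generalizing S with
  | empty => simp
  | insert a K ha ih =>
    have haK : a ∉ K := fun h => lt_irrefl a (ha a h)
    rw [Finset.prod_insert haK, Finset.card_insert_of_notMem haK]
    by_cases haS : a ∈ S
    · have hmin : ∀ u ∈ S, a ≤ u := by
        intro u hu
        rcases hS u hu with h | h
        · rcases Finset.mem_insert.1 h with rfl | h
          · exact le_rfl
          · exact (ha u h).le
        · exact (h a (Finset.mem_insert_self _ _)).le
      rw [leaderSeries_eq_rootedSeries_mul _ q haS hmin, if_pos (Finset.mem_insert_self _ _),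
        one_mul, Finset.erase_insert haK, SetSeries.mul_apply_congr
          (g' := (∏ v ∈ K, -indepSeriesAt G v) * leaderSeries G ∅ (q + K.card))]
      · have h1 : rootedSeries G a = -indepSeriesAt G a * leaderSeries G ∅ 1 := by
          rw [neg_mul, indepSeriesAt_mul_leaderSeries, neg_neg]
        have h2 : leaderSeries G ∅ (q + ((K.card + 1 : ℕ) : ℤ)) =
            leaderSeries G ∅ 1 * leaderSeries G ∅ (q + K.card) := by
          rw [← leaderSeries_add]
          congr 1
          push_cast
          ring
        rw [h1, h2]
        congr 1
        ring
      · intro T _ hT0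
        refine ih _ fun u hu => ?_
        rw [Finset.mem_sdiff] at hu
        have hua : u ≠ a := fun h => hu.2 (h ▸ mem_of_rootedSeries_ne_zero hT0)
        rcases hS u hu.1 with h | h
        · exact .inl ((Finset.mem_insert.1 h).resolve_left hua)
        · exact .inr fun v hv => h v (Finset.mem_insert_of_mem hv)
    -- Both sides are zero: `a` can neither be a leader in `S` nor lie in a block of `S`.
    · rw [mul_assoc, neg_mul, SetSeries.neg_apply, indepSeriesAt_mul_apply_of_notMem haS, neg_zero]
      simp only [leaderSeries]
      refine Finset.sum_eq_zero fun A _ => if_neg fun h => haS ?_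
      exact leaders_subset _ _ (h (Finset.mem_insert_self _ _))

-- Removing an independent set `T` of sinks containing `m` leaves an arbitrary orientation of the
-- rest. Inclusion–exclusion over such `T` isolates the unique sink `m`, provided that `m` is the
-- only leader lost with `T`.
open Classical in
theorem indepSeriesAt_mul_leaderSeries_univ {m : V} (K : Finset V) (hm : m ∈ K) (q : ℤ)
    (hmin : ∀ v, m ≤ v) (hG : ∀ v, v ≠ m → ∃ u < v, G.Adj u v) :
    -(indepSeriesAt G m * leaderSeries G (K.erase m) q) Finset.univ =
      ∑ A ∈ acyclicOrientationsOn G Finset.univ,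
        if sinksIn Finset.univ A = {m} then leaderWeight K q (leaders Finset.univ A) else 0 := by
  have h : ∀ T ∈ (Finset.univ : Finset V).powerset,
      indepSeriesAt G m T * leaderSeries G (K.erase m) q (Finset.univ \ T) =
      (if m ∈ T then (-1) ^ T.card else 0) *
        ∑ A ∈ acyclicOrientationsOn G Finset.univ,
          if T ⊆ sinksIn Finset.univ A then leaderWeight K q (leaders Finset.univ A) else 0 := by
    intro T _
    by_cases hmT : m ∈ T
    swap
    · simp only [indepSeriesAt, if_neg hmT, zero_mul]
    simp only [indepSeriesAt, if_pos hmT]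
    rw [indepSeries_apply, mul_assoc]
    simp only [leaderSeries]
    rw [← sum_acyclicOrientationsOn_closed G (Finset.subset_univ T), Finset.sum_filter]
    congr 1
    refine Finset.sum_congr rfl fun A hA => ?_
    rw [mem_acyclicOrientationsOn] at hA
    by_cases hT : T ⊆ sinksIn Finset.univ A
    · have hsink : ∀ v ∈ T, ∀ w, ¬ A v w := fun v hv => (mem_sinksIn.1 (hT hv)).2
      have hc : ∀ u ∈ T, ∀ v, A u v → v ∈ T := fun u hu v h => absurd h (hsink u hu v)
      have hn : ∀ u v, ¬ restrictRel A T u v := fun u v h => hsink u h.2.1 v h.1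
      -- A sink other than `m` receives an arc from its smaller neighbor, so it is not a leader; `m`
      -- is a leader, being the least vertex.
      have hL : leaders Finset.univ A ∩ T = {m} := by
        ext x
        rw [Finset.mem_inter, mem_leaders, Finset.mem_singleton]
        constructor
        · rintro ⟨⟨-, h1⟩, h2⟩
          by_contra hx
          obtain ⟨u, hu, hux⟩ := hG x hx
          rcases (hA.1 u x).2 ⟨hux, Finset.mem_univ _, Finset.mem_univ _⟩ with h3 | h3
          · exact h1 u hu (.single h3)
          · exact hsink x h2 u h3
        · rintro rfl
          exact ⟨⟨Finset.mem_univ _, fun j hj => absurd (hmin j) (not_le.2 hj)⟩, hmT⟩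
      rw [if_pos hc, if_pos hn, if_pos hT, one_mul, leaders_sdiff hA hc,
        leaderWeight_of_inter_eq q hL, if_pos hm, one_mul]
    · rw [if_neg hT]
      by_cases hc : ∀ u ∈ T, ∀ v, A u v → v ∈ T
      · rw [if_pos hc, if_neg, zero_mul]
        exact fun hn => hT fun v hv => mem_sinksIn.2 ⟨Finset.mem_univ _, fun w hw =>
          hn v w ⟨hw, hv, hc v hv w hw⟩⟩
      · rw [if_neg hc]
  rw [SetSeries.mul_apply, Finset.sum_congr rfl h, sum_powerset_mul_sum_ite_subset _ _ _
      (fun _ _ => Finset.subset_univ _) (fun T => if m ∈ T then (-1) ^ T.card else 0),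
      ← Finset.sum_neg_distrib]
  refine Finset.sum_congr rfl fun A _ => ?_
  rw [sum_powerset_neg_one_pow_card_of_mem]
  split_ifs <;> simp

end Series

/-! ### Colorings as powers of the independent-set series. -/

section Colorings

variable {V : Type*} [Fintype V] [DecidableEq V] {G : SimpleGraph V}

open Classical in
/-- The proper colorings of `G[S]` with colors `1, …, k`, extended by `0` outside of `S`. -/
noncomputable def properColorings (G : SimpleGraph V) (k : ℕ) (S : Finset V) : Finset (V → ℕ) :=
  (Fintype.piFinset fun v => if v ∈ S then Finset.Icc 1 k else {0}).filter
    fun f => ∀ u ∈ S, ∀ v ∈ S, G.Adj u v → f u ≠ f v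

theorem mem_properColorings {k : ℕ} {S : Finset V} {f : V → ℕ} :
    f ∈ properColorings G k S ↔ ((∀ v ∈ S, 1 ≤ f v ∧ f v ≤ k) ∧ ∀ v ∉ S, f v = 0) ∧
      ∀ u ∈ S, ∀ v ∈ S, G.Adj u v → f u ≠ f v := by
  simp only [properColorings, Finset.mem_filter, Fintype.mem_piFinset]
  refine and_congr_left' ⟨fun h => ⟨fun v hv => ?_, fun v hv => ?_⟩, fun h v => ?_⟩
  · simpa [hv] using h v
  · simpa [hv] using h v
  · by_cases hv : v ∈ S
    · simpa [hv] using h.1 v hv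
    · simpa [hv] using h.2 v hv

-- The set `T` is the class of the last color; it must be independent, and the other vertices use
-- the first `k` colors.
open Classical in
theorem card_properColorings_succ (k : ℕ) (S : Finset V) :
    (properColorings G (k + 1) S).card = ∑ T ∈ S.powerset,
      if ∀ u ∈ T, ∀ v ∈ T, ¬ G.Adj u v then (properColorings G k (S \ T)).card else 0 := by
  rw [Finset.card_eq_sum_card_fiberwise (f := fun f => S.filter (f · = k + 1))
    (t := S.powerset)
    (fun f _ => Finset.mem_coe.2 (Finset.mem_powerset.2 (Finset.filter_subset _ _)))]
  refine Finset.sum_congr rfl fun T hT => ?_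
  rw [Finset.mem_powerset] at hT
  split_ifs with hind
  · refine Finset.card_nbij' (fun f v => if v ∈ T then 0 else f v)
      (fun g v => if v ∈ T then k + 1 else g v) ?_ ?_ ?_ ?_
    · intro f hf
      simp only [Finset.coe_filter, Set.mem_ofPred_eq, mem_properColorings] at hf
      obtain ⟨⟨⟨h1, h2⟩, h3⟩, rfl⟩ := hf
      simp only [Finset.mem_coe, mem_properColorings, Finset.mem_sdiff, Finset.mem_filter]
      refine ⟨⟨fun v hv => ?_, fun v hv => ?_⟩, fun u hu v hv huv => ?_⟩
      · have := h1 v hv.1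
        have h4 : f v ≠ k + 1 := fun h => hv.2 ⟨hv.1, h⟩
        rw [if_neg hv.2]
        omega
      · split_ifs with h
        · rfl
        · exact h2 v fun h' => hv ⟨h', h⟩
      · rw [if_neg hu.2, if_neg hv.2]
        exact h3 u hu.1 v hv.1 huv
    · intro g hg
      simp only [Finset.mem_coe, mem_properColorings, Finset.mem_sdiff] at hg
      obtain ⟨⟨h1, h2⟩, h3⟩ := hg
      simp only [Finset.coe_filter, Set.mem_ofPred_eq, mem_properColorings]
      refine ⟨⟨⟨fun v hv => ?_, fun v hv => ?_⟩, fun u hu v hv huv => ?_⟩, ?_⟩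
      · split_ifs with h
        · omega
        · have := h1 v ⟨hv, h⟩
          omega
      · rw [if_neg fun h => hv (hT h)]
        exact h2 v fun h => hv h.1
      · by_cases huT : u ∈ T <;> by_cases hvT : v ∈ T
        · exact absurd huv (hind u huT v hvT)
        · have := h1 v ⟨hv, hvT⟩
          rw [if_pos huT, if_neg hvT]
          omega
        · have := h1 u ⟨hu, huT⟩
          rw [if_neg huT, if_pos hvT]
          omega
        · rw [if_neg huT, if_neg hvT]
          exact h3 u ⟨hu, huT⟩ v ⟨hv, hvT⟩ huv
      · ext v
        rw [Finset.mem_filter]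
        constructor
        · rintro ⟨hv, h⟩
          by_contra hvT
          rw [if_neg hvT] at h
          have := h1 v ⟨hv, hvT⟩
          omega
        · exact fun hv => ⟨hT hv, if_pos hv⟩
    · intro f hf
      simp only [Finset.coe_filter, Set.mem_ofPred_eq, mem_properColorings] at hf
      obtain ⟨-, rfl⟩ := hf
      ext v
      by_cases hv : v ∈ S.filter (f · = k + 1)
      · simp only [if_pos hv, (Finset.mem_filter.1 hv).2]
      · simp only [if_neg hv]
    · intro g hg
      simp only [Finset.mem_coe, mem_properColorings, Finset.mem_sdiff] at hg
      ext v
      by_cases hv : v ∈ T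
      · simp only [if_pos hv]
        exact (hg.1.2 v fun h => h.2 hv).symm
      · simp only [if_neg hv]
  · rw [Finset.card_eq_zero, Finset.eq_empty_iff_forall_notMem]
    intro f hf
    rw [Finset.mem_filter, mem_properColorings] at hf
    obtain ⟨⟨-, h3⟩, rfl⟩ := hf
    refine hind fun u hu v hv huv => ?_
    rw [Finset.mem_filter] at hu hv
    exact h3 u hu.1 v hv.1 huv (hu.2.trans hv.2.symm)

theorem indepSeries_pow_apply (k : ℕ) (S : Finset V) :
    (indepSeries G ^ k) S = (-1) ^ S.card * (properColorings G k S).card := by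
  classical
  induction k generalizing S with
  | zero =>
    rw [pow_zero, SetSeries.one_apply]
    rcases S.eq_empty_or_nonempty with rfl | ⟨v, hv⟩
    · have : properColorings G 0 ∅ = {fun _ => 0} := by
        ext f
        simp [mem_properColorings, funext_iff]
      simp [this]
    · have : properColorings G 0 S = ∅ := by
        rw [Finset.eq_empty_iff_forall_notMem]
        intro f hf
        have := (mem_properColorings.1 hf).1.1 v hv
        omega
      simp [this, Finset.ne_empty_of_mem hv]
  | succ k ih =>
    rw [pow_succ', SetSeries.mul_apply, card_properColorings_succ, Nat.cast_sum, Finset.mul_sum]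
    refine Finset.sum_congr rfl fun T hT => ?_
    rw [ih, ← Finset.card_sdiff_add_card_eq_card (Finset.mem_powerset.1 hT)]
    simp only [indepSeries]
    split_ifs
    · ring
    · simp

theorem card_properColorings_univ (k : ℕ) :
    (properColorings G k Finset.univ).card = Nat.card (G.Coloring (Fin k)) := by
  classical
  have : Finite (G.Coloring (Fin k)) := Finite.of_injective (fun f v => f v) DFunLike.coe_injective
  have := Fintype.ofFinite (G.Coloring (Fin k))
  rw [Nat.card_eq_fintype_card, ← Finset.card_univ]
  symm
  -- Colors are shifted by one because `0` is reserved for uncolored vertices.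
  refine Finset.card_bij (fun C _ v => (C v).val + 1) ?_ ?_ ?_
  · intro C _
    refine mem_properColorings.2 ⟨⟨fun v _ => ⟨by omega, (C v).isLt⟩,
      fun v hv => absurd (Finset.mem_univ v) hv⟩, fun u _ v _ huv h => C.valid huv ?_⟩
    exact Fin.ext (Nat.succ_injective h)
  · intro C _ D _ h
    exact DFunLike.ext _ _ fun v => Fin.ext (Nat.succ_injective (congrFun h v))
  · intro f hf
    obtain ⟨⟨h1, -⟩, h3⟩ := mem_properColorings.1 hf
    have h1 := fun v => h1 v (Finset.mem_univ v)
    refine ⟨SimpleGraph.Coloring.mk (fun v => ⟨f v - 1, by have := h1 v; omega⟩) ?_,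
      Finset.mem_univ _, ?_⟩
    · intro u v huv h
      have := h1 u
      have := h1 v
      have := congrArg Fin.val h
      exact h3 u (Finset.mem_univ _) v (Finset.mem_univ _) huv (by simp only at this; omega)
    · ext v
      have := h1 v
      change f v - 1 + 1 = f v
      omega

end Colorings

/-! ### Extracting the falling factorial of a clique. -/

section Cliques

variable {V : Type*} [DecidableEq V] {G : SimpleGraph V}

/-- The vertex `m` lies in exactly one of the `k + 1` blocks, and by commutativity each position
contributes equally. -/
theorem indepSeries_pow_succ_apply {m : V} (k : ℕ) {S : Finset V} (hm : m ∈ S) :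
    (indepSeries G ^ (k + 1)) S = (k + 1) * (indepSeriesAt G m * indepSeries G ^ k) S := by
  induction k generalizing S with
  | zero => simp [indepSeriesAt, hm]
  | succ k ih =>
    have h : (indepSeries G ^ (k + 1 + 1)) S =
        (indepSeriesAt G m * indepSeries G ^ (k + 1)) S +
        (k + 1) * (indepSeries G * (indepSeriesAt G m * indepSeries G ^ k)) S := by
      rw [pow_succ' _ (k + 1), SetSeries.mul_apply, SetSeries.mul_apply, SetSeries.mul_apply,
        Finset.mul_sum, ← Finset.sum_add_distrib]
      refine Finset.sum_congr rfl fun T hT => ?_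
      by_cases hmT : m ∈ T
      · rw [indepSeriesAt_mul_apply_of_notMem (S := S \ T) (by simp [hmT])]
        simp [indepSeriesAt, hmT]
      · rw [ih (by simp [hm, hmT])]
        simp only [indepSeriesAt, if_neg hmT]
        ring
    rw [h, mul_left_comm, ← pow_succ']
    push_cast
    ring

theorem prod_indepSeriesAt_apply_eq_zero {m : V} (K : Finset V) (hK : ∀ v ∈ K, G.Adj v m)
    {T : Finset V} (hm : m ∈ T) : (∏ v ∈ K, indepSeriesAt G v) T = 0 := by
  induction K using Finset.induction_on generalizing T with
  | empty => simp [SetSeries.one_apply, Finset.ne_empty_of_mem hm]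
  | insert a K ha ih =>
    rw [Finset.prod_insert ha, SetSeries.mul_apply]
    refine Finset.sum_eq_zero fun R _ => ?_
    by_cases hmR : m ∈ R
    · have : indepSeriesAt G a R = 0 := by
        simp only [indepSeriesAt, indepSeries]
        split_ifs with h1 h2
        · exact absurd (hK a (Finset.mem_insert_self _ _)) (h2 a h1 m hmR)
        · rfl
        · rfl
      rw [this, zero_mul]
    · rw [ih (fun v hv => hK v (Finset.mem_insert_of_mem hv)) (by simp [hm, hmR]), mul_zero]

/-- Clique vertices occupy different blocks. Placing a new vertex `a` amounts to choosing one of the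
factors not yet claimed by `K`, since blocks of `K` cannot contain `a`. -/
theorem indepSeries_pow_add_card_apply {K S : Finset V} (hK : G.IsClique K) (hKS : K ⊆ S)
    (k : ℕ) : (indepSeries G ^ (k + K.card)) S =
      (∏ j ∈ Finset.range K.card, ((k + K.card : ℕ) - (j : ℤ))) *
        ((∏ v ∈ K, indepSeriesAt G v) * indepSeries G ^ k) S := by
  induction K using Finset.induction_on generalizing k with
  | empty => simp
  | insert a K ha ih =>
    have hadj : ∀ v ∈ K, G.Adj v a := fun v hv => hK (Finset.mem_insert_of_mem hv)
      (Finset.mem_insert_self _ _) fun h => ha (h ▸ hv)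
    have haS : a ∈ S := hKS (Finset.mem_insert_self _ _)
    have h1 : ((∏ v ∈ K, indepSeriesAt G v) * indepSeries G ^ (k + 1)) S =
        (k + 1) * ((∏ v ∈ insert a K, indepSeriesAt G v) * indepSeries G ^ k) S := by
      rw [Finset.prod_insert ha, mul_comm (indepSeriesAt G a), mul_assoc, SetSeries.mul_apply,
        SetSeries.mul_apply, Finset.mul_sum]
      refine Finset.sum_congr rfl fun T _ => ?_
      by_cases haT : a ∈ T
      · rw [prod_indepSeriesAt_apply_eq_zero K hadj haT]
        simp
      · rw [indepSeries_pow_succ_apply (m := a) k (S := S \ T) (by simp [haS, haT])]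
        ring
    have h2 := ih (hK.subset (by simp)) ((Finset.subset_insert _ _).trans hKS) (k + 1)
    rw [h1] at h2
    rw [Finset.card_insert_of_notMem ha, ← add_assoc, add_right_comm, h2, Finset.prod_range_succ]
    push_cast
    ring

end Cliques

/-! ### Source-components described by their leaders. -/

namespace GraphOrientation

variable {n : ℕ} {G : SimpleGraph (Fin n)} (γ : GraphOrientation G)

theorem mem_nextPart_of_isLeast {C : Set (Fin n)} {m v : Fin n} (hm : IsLeast Cᶜ m) :
    v ∈ γ.nextPart C ↔ v ∈ γ.reachable m ∧ v ∉ C := by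
  constructor
  · rintro ⟨m', hm', h⟩
    exact hm'.unique hm ▸ h
  · exact fun h => ⟨m, hm, h⟩

theorem covered_closed (k : ℕ) {u v : Fin n} (hu : u ∈ γ.covered k)
    (h : Relation.ReflTransGen γ.Arc u v) : v ∈ γ.covered k := by
  induction k with
  | zero => exact hu.elim
  | succ k ih =>
    rcases hu with hu | ⟨m, hm, hmu, -⟩
    · exact .inl (ih hu)
    · by_cases hv : v ∈ γ.covered k
      · exact .inl hv
      · exact .inr ⟨m, hm, Relation.ReflTransGen.trans hmu h, hv⟩

/-- The successive minima strictly increase, so everything covered so far was reached from a vertex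
below the current minimum. -/
theorem exists_lt_of_mem_covered (k : ℕ) {m v : Fin n} (hm : IsLeast (γ.covered k)ᶜ m)
    (hv : v ∈ γ.covered k) : ∃ j < m, Relation.ReflTransGen γ.Arc j v := by
  induction k generalizing m with
  | zero => exact hv.elim
  | succ k ih =>
    have hmk : m ∉ γ.covered k := fun h => hm.1 (.inl h)
    have key : ∀ m', IsLeast (γ.covered k)ᶜ m' → m' < m := by
      intro m' hm'
      refine lt_of_le_of_ne (hm'.2 hmk) ?_
      rintro rfl
      exact hm.1 (.inr ⟨m', hm', .refl, hmk⟩)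
    rcases hv with hv | ⟨m', hm', hv, -⟩
    · obtain ⟨m', hm'⟩ : ∃ m', IsLeast (γ.covered k)ᶜ m' :=
        ⟨_, wellFounded_lt.min_mem _ ⟨m, hmk⟩,
          fun x hx => not_lt.1 (wellFounded_lt.not_lt_min _ hx)⟩
      obtain ⟨j, hj, h⟩ := ih hm' hv
      exact ⟨j, hj.trans (key m' hm'), h⟩
    · exact ⟨m', key m' hm', hv⟩

/-- The vertices that are reachable from `m` and from no vertex smaller than `m`. -/
def componentAt (m : Fin n) : Set (Fin n) :=
  {v | Relation.ReflTransGen γ.Arc m v ∧ ∀ j < m, ¬ Relation.ReflTransGen γ.Arc j v}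

theorem nextPart_eq_componentAt (k : ℕ) {m : Fin n} (hm : IsLeast (γ.covered k)ᶜ m) :
    γ.nextPart (γ.covered k) = γ.componentAt m := by
  ext v
  rw [mem_nextPart_of_isLeast γ hm]
  refine and_congr_right fun _ => ⟨fun hv j hj h => hv (γ.covered_closed k ?_ h), fun h hv => ?_⟩
  · by_contra hjc
    exact absurd (hm.2 hjc) (not_le.2 hj)
  · obtain ⟨j, hj, h'⟩ := γ.exists_lt_of_mem_covered k hm hv
    exact h j hj h'

theorem mem_leaders_univ {m : Fin n} : m ∈ leaders Finset.univ γ.Arc ↔ m ∈ γ.componentAt m := by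
  rw [mem_leaders]
  exact ⟨fun h => ⟨.refl, h.2⟩, fun h => ⟨Finset.mem_univ m, h.2⟩⟩

/-- A leader can only be covered at the step where it is itself the minimum. Otherwise it would stay
uncovered forever, while the covered set gains a vertex at every step, exceeding `n`. -/
theorem exists_isLeast_of_mem_leaders {m : Fin n} (hm : m ∈ leaders Finset.univ γ.Arc) :
    ∃ k, IsLeast (γ.covered k)ᶜ m := by
  by_contra! h
  have key : ∀ k : ℕ, m ∉ γ.covered k := by
    intro k
    induction k with
    | zero => exact fun h => h.elim
    | succ k ih =>
      rintro (h' | ⟨m', hm', h', -⟩)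
      · exact ih h'
      · rcases (hm'.2 ih).eq_or_lt with rfl | hlt
        · exact h k hm'
        · exact (mem_leaders.1 hm).2 m' hlt h'
  have hcard : ∀ k : ℕ, k ≤ (γ.covered k).ncard := by
    intro k
    induction k with
    | zero => exact Nat.zero_le _
    | succ k ih =>
      refine Nat.succ_le_of_lt (ih.trans_lt (Set.ncard_lt_ncard ?_ (Set.toFinite _)))
      have hmin : IsLeast (γ.covered k)ᶜ (wellFounded_lt.min _ ⟨m, key k⟩) :=
        ⟨wellFounded_lt.min_mem _ _, fun x hx => not_lt.1 (wellFounded_lt.not_lt_min _ hx)⟩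
      exact ⟨Set.subset_union_left, fun hsub =>
        hmin.1 (hsub (.inr ⟨_, hmin, .refl, hmin.1⟩))⟩
  have h1 := hcard (n + 1)
  have h2 := Set.ncard_le_card (γ.covered (n + 1))
  rw [Nat.card_eq_fintype_card, Fintype.card_fin] at h2
  omega

theorem sourceComponents_eq_image :
    γ.sourceComponents = γ.componentAt '' (leaders Finset.univ γ.Arc : Set (Fin n)) := by
  ext S
  constructor
  · rintro ⟨⟨v, hv⟩, k, rfl⟩
    obtain ⟨m, hm, -⟩ := id hv
    rw [γ.nextPart_eq_componentAt k hm]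
    refine ⟨m, γ.mem_leaders_univ.2 ?_, rfl⟩
    rw [← γ.nextPart_eq_componentAt k hm, mem_nextPart_of_isLeast γ hm]
    exact ⟨.refl, hm.1⟩
  · rintro ⟨m, hm, rfl⟩
    obtain ⟨k, hk⟩ := γ.exists_isLeast_of_mem_leaders hm
    exact ⟨⟨m, γ.mem_leaders_univ.1 hm⟩, k, (γ.nextPart_eq_componentAt k hk).symm⟩

theorem eq_of_mem_componentAt {m v : Fin n} (hv : v ∈ leaders Finset.univ γ.Arc)
    (h : v ∈ γ.componentAt m) : v = m := by
  rcases lt_trichotomy v m with hlt | rfl | hlt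
  · exact absurd .refl (h.2 v hlt)
  · rfl
  · exact absurd h.1 ((mem_leaders.1 hv).2 m hlt)

theorem ncard_sourceComponents :
    γ.sourceComponents.ncard = (leaders Finset.univ γ.Arc).card := by
  rw [sourceComponents_eq_image, Set.InjOn.ncard_image, Set.ncard_coe_finset]
  intro m hm m' _ h
  exact γ.eq_of_mem_componentAt hm (h ▸ γ.mem_leaders_univ.1 hm)

theorem exists_leader_mem_componentAt (v : Fin n) :
    ∃ m ∈ leaders Finset.univ γ.Arc, v ∈ γ.componentAt m := by
  have hne : {j | Relation.ReflTransGen γ.Arc j v}.Nonempty := ⟨v, .refl⟩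
  have h1 : Relation.ReflTransGen γ.Arc (wellFounded_lt.min _ hne) v := wellFounded_lt.min_mem _ hne
  have h2 : ∀ j < wellFounded_lt.min _ hne, ¬ Relation.ReflTransGen γ.Arc j v :=
    fun j hj h => wellFounded_lt.not_lt_min _
      (show j ∈ {j | Relation.ReflTransGen γ.Arc j v} from h) hj
  exact ⟨_, mem_leaders.2 ⟨Finset.mem_univ _, fun j hj h => h2 j hj (h.trans h1)⟩, h1, h2⟩

/-- A non-leader among the first `d` vertices shares its component with a smaller leader, again
among the first `d`. Conversely, a component contains only one leader. -/
theorem separated_iff_subset_leaders (d : ℕ) :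
    (∀ u v : Fin n, u.val < d → v.val < d → u ≠ v →
      ∀ S ∈ γ.sourceComponents, u ∈ S → v ∉ S) ↔
    Finset.univ.filter (fun v : Fin n => v.val < d) ⊆ leaders Finset.univ γ.Arc := by
  rw [sourceComponents_eq_image]
  constructor
  · intro h v hv
    obtain ⟨m, hm, hvm⟩ := γ.exists_leader_mem_componentAt v
    by_cases hmv : m = v
    · exact hmv ▸ hm
    have hlt : m < v := by
      by_contra hle
      exact hvm.2 v (lt_of_le_of_ne (not_lt.1 hle) (Ne.symm hmv)) .refl
    have hvd : v.val < d := (Finset.mem_filter.1 hv).2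
    exact absurd hvm (h m v (lt_trans hlt hvd) hvd hmv _ ⟨m, hm, rfl⟩ (γ.mem_leaders_univ.1 hm))
  · rintro h u v hu hv huv _ ⟨m, -, rfl⟩ hum hvm
    exact huv ((γ.eq_of_mem_componentAt (h (by simpa using hu)) hum).trans
      (γ.eq_of_mem_componentAt (h (by simpa using hv)) hvm).symm)

end GraphOrientation

/-! ### From counts and values to polynomials. -/

theorem IsAcyclicOrientationOn.asymm {V : Type*} {G : SimpleGraph V} {S : Finset V}
    {A : V → V → Prop} (hA : IsAcyclicOrientationOn G S A) (u v : V) (h : A u v) : ¬ A v u :=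
  fun h' => hA.2 u (.tail (.single h) h')

theorem card_graphOrientation_eq {V : Type*} [Fintype V] (G : SimpleGraph V)
    (p : (V → V → Prop) → Prop) [DecidablePred p] :
    Nat.card {γ : GraphOrientation G // γ.IsAcyclic ∧ p γ.Arc} =
      ((acyclicOrientationsOn G Finset.univ).filter p).card := by
  have e : {γ : GraphOrientation G // γ.IsAcyclic ∧ p γ.Arc} ≃
      {A // A ∈ (acyclicOrientationsOn G Finset.univ).filter p} :=
    { toFun γ := ⟨γ.1.Arc, Finset.mem_filter.2
        ⟨mem_acyclicOrientationsOn.2 ⟨fun u v => by simpa using (γ.1.adj_iff u v).symm, γ.2.1⟩,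
          γ.2.2⟩⟩
      invFun A :=
        have hA := mem_acyclicOrientationsOn.1 (Finset.mem_filter.1 A.2).1
        ⟨⟨A.1, fun u v => by simpa using (hA.1 u v).symm, hA.asymm⟩, hA.2,
          (Finset.mem_filter.1 A.2).2⟩
      left_inv _ := rfl
      right_inv _ := rfl }
  rw [Nat.card_congr e, Nat.card_eq_fintype_card, Fintype.card_coe]

theorem SetSeries.neg_one_pow_mul_apply {V : Type*} [DecidableEq V] (c : ℕ) (f : SetSeries V)
    (S : Finset V) : ((-1) ^ c * f) S = (-1) ^ c * f S := by
  rcases neg_one_pow_eq_or (SetSeries V) c with h | h <;>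
  rcases Nat.even_or_odd c with hc | hc <;> simp [hc]

theorem Polynomial.eq_of_eval_natCast_add_eq {p q : ℤ[X]} (d : ℤ)
    (h : ∀ k : ℕ, p.eval ((k : ℤ) + d) = q.eval ((k : ℤ) + d)) : p = q := by
  refine Polynomial.eq_of_infinite_eval_eq _ _ (Set.Infinite.mono ?_
    (Set.infinite_range_of_injective (f := fun k : ℕ => (k : ℤ) + d) ?_))
  · rintro _ ⟨k, rfl⟩
    exact h k
  · intro a b h
    simpa using h

theorem fallingPolynomial_monic (d : ℕ) : (fallingPolynomial d).Monic :=
  monic_prod_of_monic _ _ fun _ _ => monic_X_sub_C _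

theorem fallingPolynomial_eval (d : ℕ) (x : ℤ) :
    (fallingPolynomial d).eval x = ∏ j ∈ Finset.range d, (x - (j : ℤ)) := by
  simp [fallingPolynomial, eval_prod]

theorem chromaticPolynomial_eval_eq_indepSeries_pow {V : Type*} [Fintype V] [DecidableEq V]
    (G : SimpleGraph V) (k : ℕ) (hk : 0 < k) : (chromaticPolynomial G).eval (k : ℤ) =
      (-1) ^ Fintype.card V * (indepSeries G ^ k) Finset.univ := by
  rw [chromaticPolynomial_eval G k hk, indepSeries_pow_apply, card_properColorings_univ,
    Finset.card_univ, ← mul_assoc, ← mul_pow]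
  simp

open Classical in
/-- The generating polynomial of the acyclic orientations in the set `a` in which all elements of
`K` are leaders, by the number of the other leaders. -/
noncomputable def leaderPolynomial {V : Type*} [Fintype V] [LinearOrder V] (K : Finset V)
    (a : Finset (V → V → Prop)) : ℤ[X] :=
  ∑ A ∈ a, if K ⊆ leaders Finset.univ A then X ^ (leaders Finset.univ A \ K).card else 0

section LeaderPolynomial

variable {V : Type*} [Fintype V] [LinearOrder V]

theorem leaderPolynomial_eval (K : Finset V) (a : Finset (V → V → Prop)) (q : ℤ) :
    (leaderPolynomial K a).eval q = ∑ A ∈ a, leaderWeight K q (leaders Finset.univ A) := by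
  classical
  rw [leaderPolynomial, eval_finsetSum]
  refine Finset.sum_congr rfl fun A _ => ?_
  unfold leaderWeight
  split_ifs <;> simp

open Classical in
theorem leaderPolynomial_coeff (K : Finset V) (a : Finset (V → V → Prop)) (i : ℕ) :
    (leaderPolynomial K a).coeff i = (a.filter fun A => K ⊆ leaders Finset.univ A ∧
      (leaders Finset.univ A).card = K.card + i).card := by
  rw [leaderPolynomial, finsetSum_coeff, Finset.card_filter, Nat.cast_sum]
  refine Finset.sum_congr rfl fun A _ => ?_
  by_cases h : K ⊆ leaders Finset.univ A
  · have h1 := Finset.card_sdiff_add_card_eq_card h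
    have h2 : (leaders Finset.univ A).card = K.card + i ↔
      i = (leaders Finset.univ A \ K).card := by omega
    rw [if_pos h, coeff_X_pow]
    by_cases h3 : i = (leaders Finset.univ A \ K).card
    · rw [if_pos h3, if_pos ⟨h, h2.2 h3⟩, Nat.cast_one]
    · rw [if_neg h3, if_neg fun h4 => h3 (h2.1 h4.2), Nat.cast_zero]
  · simp [h]

end LeaderPolynomial

/-! ### The quotient polynomial and its shift. -/

section Clique

variable {n d : ℕ} {G : SimpleGraph (Fin n)}

/-- The first `d` vertices. -/
def firstVertices (n d : ℕ) : Finset (Fin n) := Finset.univ.filter fun v => v.val < d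

theorem mem_firstVertices {v : Fin n} : v ∈ firstVertices n d ↔ v.val < d := by
  simp [firstVertices]

theorem card_firstVertices (hdn : d ≤ n) : (firstVertices n d).card = d := by
  rw [firstVertices, Fin.card_filter_val_lt, min_eq_right hdn]

theorem prod_indepSeriesAt_mul_pow_apply (hdn : d ≤ n) (k : ℕ) :
    ((∏ v ∈ firstVertices n d, indepSeriesAt G v) * indepSeries G ^ k) Finset.univ =
      (-1) ^ d * leaderSeries G (firstVertices n d) (-(k + d : ℤ)) Finset.univ := by
  rw [leaderSeries_eq_prod_mul, Finset.prod_neg, card_firstVertices hdn, mul_assoc,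
    SetSeries.neg_one_pow_mul_apply, ← mul_assoc, ← mul_pow, ← leaderSeries_neg_natCast]
  · simp
  · intro u _
    by_cases hu : u.val < d
    · exact .inl (mem_firstVertices.2 hu)
    · exact .inr fun v hv => Fin.lt_def.2 (by have := mem_firstVertices.1 hv; omega)

-- The factor of the first vertex is kept for the sink argument; only the other `d - 1` clique
-- factors are absorbed into leaders, whence `d - 1` in place of `d`.
open Classical in
theorem prod_indepSeriesAt_mul_pow_apply' (hd : 0 < d) (hdn : d ≤ n) (hG : HasSmallerNeighbors G)
    (k : ℕ) :
    ((∏ v ∈ firstVertices n d, indepSeriesAt G v) * indepSeries G ^ k) Finset.univ =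
      (-1) ^ d * ∑ A ∈ (acyclicOrientationsOn G Finset.univ).filter
        (fun A => sinksIn Finset.univ A = {⟨0, hd.trans_le hdn⟩}),
        leaderWeight (firstVertices n d) (-(k + (d - 1) : ℤ)) (leaders Finset.univ A) := by
  set z : Fin n := ⟨0, hd.trans_le hdn⟩
  have hz : z ∈ firstVertices n d := mem_firstVertices.2 hd
  rw [Finset.sum_filter, ← indepSeriesAt_mul_leaderSeries_univ _ hz _ (fun v => Nat.zero_le v.val)]
  · have hcongr : (indepSeriesAt G z * leaderSeries G ((firstVertices n d).erase z)
        (-(k + (d - 1) : ℤ))) Finset.univ =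
        (indepSeriesAt G z * ((∏ v ∈ (firstVertices n d).erase z, -indepSeriesAt G v) *
          leaderSeries G ∅ (-k))) Finset.univ := by
      refine SetSeries.mul_apply_congr fun T _ hT => ?_
      rw [leaderSeries_eq_prod_mul]
      · rw [Finset.card_erase_of_mem hz, card_firstVertices hdn, Nat.cast_sub hd]
        congr 3
        push_cast
        ring
      · intro u hu
        by_cases hud : u.val < d
        · refine .inl (Finset.mem_erase.2 ⟨fun h => hT ?_, mem_firstVertices.2 hud⟩)
          rw [h] at hu
          simp only [indepSeriesAt, if_neg (Finset.mem_sdiff.1 hu).2]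
        · refine .inr fun v hv => Fin.lt_def.2 ?_
          have := mem_firstVertices.1 (Finset.mem_of_mem_erase hv)
          omega
    rw [hcongr, ← SetSeries.neg_apply, ← neg_mul, ← mul_assoc,
      Finset.mul_prod_erase _ (fun v => -indepSeriesAt G v) hz, Finset.prod_neg,
      card_firstVertices hdn, mul_assoc, SetSeries.neg_one_pow_mul_apply, ← mul_assoc, ← mul_pow,
      leaderSeries_neg_natCast]
    simp
  · intro v hv
    obtain ⟨j, hj, h⟩ := hG v (Nat.pos_of_ne_zero fun h => hv (Fin.ext h))
    exact ⟨j, hj, h⟩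

/-- The quotient of the chromatic polynomial by the falling factorial of a clique. -/
noncomputable def cliqueQuotient (G : SimpleGraph (Fin n)) (d : ℕ) : ℤ[X] :=
  (-1) ^ (n + d) *
    (leaderPolynomial (firstVertices n d) (acyclicOrientationsOn G Finset.univ)).comp (-X)

theorem cliqueQuotient_eval (hdn : d ≤ n) (k : ℕ) : (cliqueQuotient G d).eval ((k : ℤ) + d) =
    (-1) ^ n * ((∏ v ∈ firstVertices n d, indepSeriesAt G v) * indepSeries G ^ k) Finset.univ := by
  rw [prod_indepSeriesAt_mul_pow_apply hdn]
  simp [cliqueQuotient, leaderPolynomial_eval, leaderSeries, pow_add, mul_assoc, eval_comp]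

theorem chromaticPolynomial_eq_mul_cliqueQuotient (hd : 0 < d) (hdn : d ≤ n)
    (hclique : ∀ u v : Fin n, u.val < d → v.val < d → u ≠ v → G.Adj u v) :
    chromaticPolynomial G = fallingPolynomial d * cliqueQuotient G d := by
  refine Polynomial.eq_of_eval_natCast_add_eq d fun k => ?_
  have hK : G.IsClique (firstVertices n d : Set (Fin n)) := fun u hu v hv huv =>
    hclique u v (mem_firstVertices.1 hu) (mem_firstVertices.1 hv) huv
  have h := indepSeries_pow_add_card_apply hK (Finset.subset_univ _) k
  rw [card_firstVertices hdn] at h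
  rw [eval_mul, cliqueQuotient_eval hdn, ← Nat.cast_add,
    chromaticPolynomial_eval_eq_indepSeries_pow G _ (by omega), h, fallingPolynomial_eval,
    Fintype.card_fin]
  ring

theorem chiHat_eq_cliqueQuotient (hd : 0 < d) (hdn : d ≤ n)
    (hclique : ∀ u v : Fin n, u.val < d → v.val < d → u ≠ v → G.Adj u v) :
    chiHat G d = cliqueQuotient G d := by
  rw [chiHat, chromaticPolynomial_eq_mul_cliqueQuotient hd hdn hclique,
    mul_divByMonic_cancel_left _ (fallingPolynomial_monic d)]

open Classical in
theorem cliqueQuotient_comp (hd : 0 < d) (hdn : d ≤ n) (hG : HasSmallerNeighbors G) :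
    (cliqueQuotient G d).comp (X + 1) = (-1) ^ (n + d) *
      (leaderPolynomial (firstVertices n d) ((acyclicOrientationsOn G Finset.univ).filter
        (fun A => sinksIn Finset.univ A = {⟨0, hd.trans_le hdn⟩}))).comp (-X) := by
  -- After substituting `X + 1`, the points `k + (d - 1)` become the points `k + d` where the
  -- quotient is known.
  refine Polynomial.eq_of_eval_natCast_add_eq (d - 1) fun k => ?_
  have h := cliqueQuotient_eval (G := G) hdn k
  rw [prod_indepSeriesAt_mul_pow_apply' hd hdn hG] at h
  have h1 : ((k : ℤ) + (d - 1)) + 1 = k + d := by ring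
  rw [eval_comp, eval_add, eval_X, eval_one, h1, h]
  simp only [eval_mul, eval_pow, eval_neg, eval_one, eval_comp, eval_X, leaderPolynomial_eval,
    pow_add, mul_assoc]

theorem negOnePow_mul_coeff_comp_neg_X (p : ℤ[X]) (n d i : ℕ) :
    ((((n : ℤ) - d - i).negOnePow : ℤˣ) : ℤ) * (((-1) ^ (n + d) * p.comp (-X)).coeff i) =
      p.coeff i := by
  -- The two exponents differ by the even number `2 * (d + i)`.
  have h1 : ((n : ℤ) - d - i).negOnePow = ((n + d + i : ℕ) : ℤ).negOnePow := by
    rw [Int.negOnePow_eq_iff]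
    exact ⟨-(d + i), by push_cast; ring⟩
  have h2 : ((((n : ℤ) - d - i).negOnePow : ℤˣ) : ℤ) = (-1) ^ (n + d + i) := by
    rw [h1, Int.negOnePow_def, zpow_natCast]
    simp
  have h3 : ((-1 : ℤ[X]) ^ (n + d) * p.comp (-X)).coeff i =
      (-1) ^ (n + d) * (p.comp (-X)).coeff i := by
    rw [← C_1, ← C_neg, ← C_pow, coeff_C_mul]
  have h0 : (-X : ℤ[X]) = C (-1) * X := by simp
  rw [h2, h3, h0, comp_C_mul_X_coeff, pow_add _ (n + d)]
  have h4 : ((-1 : ℤ) ^ (n + d)) * (-1) ^ (n + d) = 1 := by rw [← mul_pow]; simp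
  have h5 : ((-1 : ℤ) ^ i) * (-1) ^ i = 1 := by rw [← mul_pow]; simp
  linear_combination (p.coeff i * (-1) ^ i * (-1) ^ i) * h4 + p.coeff i * h5

/-! ### Relabeling by distance. -/

/-- Sort by distance from the first vertex, with the clique put at level zero and ties broken by the
old label. A vertex outside the clique then follows its successor on a shortest walk to the first
vertex; a clique vertex other than the first follows the first. -/
theorem exists_perm_hasSmallerNeighbors (hG : G.Connected) (hd : 0 < d) (hdn : d ≤ n)
    (hclique : ∀ u v : Fin n, u.val < d → v.val < d → u ≠ v → G.Adj u v) :
    ∃ σ : Equiv.Perm (Fin n), (∀ v : Fin n, v.val < d → σ v = v) ∧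
      HasSmallerNeighbors (G.map σ.toEmbedding) := by
  classical
  set z : Fin n := ⟨0, hd.trans_le hdn⟩
  let level : Fin n → ℕ := fun v => if v.val < d then 0 else G.dist z v
  let key : Fin n → ℕ ×ₗ Fin n := fun v => toLex (level v, v)
  have hkey : Function.Injective key := fun u v h =>
    congrArg (fun x : ℕ ×ₗ Fin n => (ofLex x).2) h
  have hlt : ∀ u v, key u < key v ↔ level u < level v ∨ level u = level v ∧ u < v :=
    fun u v => Prod.Lex.toLex_lt_toLex
  let rank : Fin n → Fin n := fun v => ⟨(Finset.univ.filter fun u => key u < key v).card, by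
    have : (Finset.univ.filter fun u => key u < key v).card < (Finset.univ : Finset (Fin n)).card :=
      Finset.card_lt_card (Finset.filter_ssubset.2 ⟨v, Finset.mem_univ _, lt_irrefl _⟩)
    simpa using this⟩
  have hmono : ∀ u v, key u < key v → rank u < rank v := by
    intro u v h
    change (Finset.univ.filter fun a => key a < key u).card <
      (Finset.univ.filter fun a => key a < key v).card
    refine Finset.card_lt_card ?_
    refine (Finset.ssubset_iff_of_subset ?_ ).2 ⟨u, ?_, ?_⟩
    · intro w hw
      simp only [Finset.mem_filter, Finset.mem_univ, true_and] at hw ⊢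
      exact hw.trans h
    · simpa using h
    · simp
  have hinj : Function.Injective rank := by
    intro u v h
    by_contra huv
    rcases lt_or_gt_of_ne (fun h => huv (hkey h)) with h' | h'
    · exact (hmono _ _ h').ne h
    · exact (hmono _ _ h').ne h.symm
  let σ : Equiv.Perm (Fin n) := Equiv.ofBijective rank (Finite.injective_iff_bijective.1 hinj)
  have hlevel : ∀ v : Fin n, ¬ v.val < d → 0 < level v := by
    intro v hv
    simp only [level, if_neg hv]
    refine hG.pos_dist_of_ne ?_
    rintro rfl
    exact hv hd
  have hfix : ∀ v : Fin n, v.val < d → σ v = v := by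
    intro v hv
    have h0 : level v = 0 := if_pos hv
    -- Level zero consists only of the first `d` vertices, in their old order, so the rank of such a
    -- vertex is its label.
    have : (Finset.univ.filter fun u => key u < key v) = Finset.univ.filter fun u => u < v := by
      ext u
      simp only [Finset.mem_filter, Finset.mem_univ, true_and, hlt, h0]
      constructor
      · rintro (h | h)
        · exact absurd h (Nat.not_lt_zero _)
        · exact h.2
      · intro h
        have hud : u.val < d := lt_trans h hv
        exact .inr ⟨if_pos hud, h⟩
    refine Fin.ext ?_
    change (Finset.univ.filter fun u => key u < key v).card = v.val
    rw [this, Finset.filter_gt_eq_Iio, Fin.card_Iio]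
  refine ⟨σ, hfix, fun k hk => ?_⟩
  obtain ⟨v, rfl⟩ := σ.surjective k
  have main : ∃ w, key w < key v ∧ G.Adj w v := by
    by_cases hv : v.val < d
    · rw [hfix v hv] at hk
      have hzv : z < v := hk
      exact ⟨z, (hlt _ _).2 (.inr ⟨(if_pos hd).trans (if_pos hv).symm, hzv⟩),
        hclique _ _ hd hv hzv.ne⟩
    · have hvz : z ≠ v := by
        rintro rfl
        exact hv hd
      obtain ⟨p, hp⟩ := hG.exists_walk_length_eq_dist v z
      cases p with
      | nil => exact absurd rfl hvz
      | @cons _ w _ hadj p =>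
        refine ⟨w, (hlt _ _).2 (.inl ?_), hadj.symm⟩
        have h1 := SimpleGraph.dist_le p
        rw [SimpleGraph.Walk.length_cons, SimpleGraph.dist_comm] at hp
        rw [SimpleGraph.dist_comm] at h1
        simp only [level, if_neg hv]
        split_ifs <;> omega
  obtain ⟨w, hw, hadj⟩ := main
  exact ⟨σ w, hmono _ _ hw, (SimpleGraph.map_adj _ _ _ _).2 ⟨w, v, hadj, rfl, rfl⟩⟩

end Clique

theorem mainTheorem4 (n d : ℕ) (G : SimpleGraph (Fin n)) (hG : G.Connected)
    (hd : 0 < d) (hdn : d ≤ n)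
    (hclique : ∀ u v : Fin n, u.val < d → v.val < d → u ≠ v → G.Adj u v) :
    (∃ σ : Equiv.Perm (Fin n), (∀ v : Fin n, v.val < d → σ v = v) ∧
      HasSmallerNeighbors (G.map σ.toEmbedding)) ∧
    chromaticPolynomial G = fallingPolynomial d * chiHat G d ∧
    (HasSmallerNeighbors G → ∀ i : ℕ,
      ((((n : ℤ) - d - i).negOnePow : ℤˣ) : ℤ) * ((chiHat G d).comp (X + 1)).coeff i =
        Nat.card {γ : GraphOrientation G //
          γ.IsAcyclic ∧
          γ.sourceComponents.ncard = d + i ∧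
          (∀ u v : Fin n, u.val < d → v.val < d → u ≠ v →
            ∀ S ∈ γ.sourceComponents, u ∈ S → v ∉ S) ∧
          (∀ v : Fin n, γ.IsSink v ↔ v = ⟨0, lt_of_lt_of_le hd hdn⟩)}) := by
  classical
  refine ⟨exists_perm_hasSmallerNeighbors hG hd hdn hclique, ?_, fun hS i => ?_⟩
  · rw [chiHat_eq_cliqueQuotient hd hdn hclique]
    exact chromaticPolynomial_eq_mul_cliqueQuotient hd hdn hclique
  · rw [chiHat_eq_cliqueQuotient hd hdn hclique, cliqueQuotient_comp hd hdn hS,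
      negOnePow_mul_coeff_comp_neg_X, leaderPolynomial_coeff, card_firstVertices hdn,
      Finset.filter_filter, ← card_graphOrientation_eq]
    refine congrArg _ (Nat.card_congr (Equiv.subtypeEquivRight fun γ => and_congr_right fun _ => ?_))
    rw [γ.ncard_sourceComponents, γ.separated_iff_subset_leaders, Finset.eq_singleton_iff_unique_mem]
    simp only [mem_sinksIn, Finset.mem_univ, true_and, GraphOrientation.IsSink, firstVertices]
    constructor
    · rintro ⟨⟨h1, h2⟩, h3, h4⟩
      exact ⟨h4, h3, fun v => ⟨h2 v, fun h => h ▸ h1⟩⟩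
    · rintro ⟨h4, h3, h⟩
      exact ⟨⟨(h _).2 rfl, fun v => (h v).1⟩, h3, h4⟩
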